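/- Let $\gamma\ge 1$ and let $\mathcal B\subset\{b\in\mathbb C:\operatorname{Re} b\ge\gamma\}$ be countably infinite. Let $s>0$ satisfy $\sum_{b\in\mathcal B}|b|^{-2s}<\infty$, and put $\theta_b(z)=1/(z+b)$ for $b\in\mathcal B$. Let $H\subset\mathbb C$ be a bounded, open, mildly regular set with $$G_\gamma:=\{z:|z-\tfrac1{2\gamma}|<\tfrac1{2\gamma}\}\subseteq H\subseteq\{z:\operatorname{Re}z>0\}.$$ Here *mildly regular* means that there are $\eta>0$ and $M\ge1$ such that any $x,y\in H$ with $|x-y|<\eta$ are joined by a Lipschitz path $\psi:[0,1]\to H$, $\psi(0)=x$, $\psi(1)=y$, with $\int_0^1|\psi'(t)|\,dt\le M|x-y|$. Let $C_{\mathbb C}(\bar H)$ and $C_{\mathbb R}(\bar H)$ be the Banach spaces of continuous complex-valued and real-valued functions on the compact set $\bar H$, with the sup norm. Then: 1. For every $f\in C_{\mathbb C}(\bar H)$ and $z\in\bar H$ the series $$(L_sf)(z)=\sum_{b\in\mathcal B}\frac{f(\theta_b(z))}{|z+b|^{2s}}$$ converges, and $L_s$ is a bounded linear map of $C_{\mathbb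 C}(\bar H)$ into itself. Its spectral radius $r(L_s)=\lim_{k\to\infty}\|L_s^k\|^{1/k}$ is positive. 2. There is a strictly positive Lipschitz function $v_s\in C_{\mathbb R}(\bar H)$ with $L_sv_s=r(L_s)v_s$. It is unique up to scalar multiples: if $u\in C_{\mathbb R}(\bar H)$ is strictly positive and $L_su=\mu u$ for some $\mu\in\mathbb C$, then $\mu=r(L_s)$ and $u=c\,v_s$ for some $c>0$. 3. The function $v_s$ satisfies, with $z=x+iy$ identified with $(x,y)$, $$v_s(z_0)\le v_s(z_1)\exp\big[(\sqrt5\,s/\gamma)|z_1-z_0|\big],\qquad z_0,z_1\in\bar H;$$ $$v_s(x_1,y)\ge v_s(x_2,y)\ge v_s(x_1,y)\exp\big[-(2s/\gamma)(x_2-x_1)\big],\qquad 0\le x_1\le x_2,\ (x_1,y),(x_2,y)\in\bar H;$$ $$v_s(x,y_1)\le v_s(x,y_2)\exp\big[(s/\gamma)|y_1-y_2|\big],\qquad (x,y_1),(x,y_2)\in\bar H.$$ 4. If $\mathcal B$ and $H$ are symmetric under complex conjugation, then $v_s(\bar z)=v_s(z)$ for all $z\in\bar H$. -/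

import Mathlib

open Set Filter Topology

/-- A set `H` of complex numbers is mildly regular if there are `η > 0` and `M ≥ 1` such that
any two points `x, y` of `H` at distance `< η` are joined inside `H` by a Lipschitz path
`ψ : [0,1] → H` of length `∫₀¹ ‖ψ'(t)‖ dt ≤ M ‖x - y‖`.  (A Lipschitz path is differentiable
almost everywhere, with bounded derivative, so that the integral is a true one.) -/
def MildlyRegular (H : Set ℂ) : Prop :=
  ∃ η : ℝ, 0 < η ∧ ∃ M : ℝ, 1 ≤ M ∧ ∀ x ∈ H, ∀ y ∈ H, ‖x - y‖ < η →
    ∃ ψ : ℝ → ℂ, (∃ K : NNReal, LipschitzOnWith K ψ (Icc 0 1)) ∧ MapsTo ψ (Icc 0 1) H ∧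
      ψ 0 = x ∧ ψ 1 = y ∧ ∫ t in (0 : ℝ)..1, ‖deriv ψ t‖ ≤ M * ‖x - y‖

/-- The open disc `G_γ` with centre and radius `1 / (2γ)`. -/
def discG (γ : ℝ) : Set ℂ := {z : ℂ | ‖z - ((1 / (2 * γ) : ℝ) : ℂ)‖ < 1 / (2 * γ)}

/-- The bounded, open, mildly regular sets `H` with `G_γ ⊆ H ⊆ {Re z > 0}`. -/
structure MoebiusDomain (γ : ℝ) where
  carrier : Set ℂ
  isOpen : IsOpen carrier
  isBounded : Bornology.IsBounded carrier
  mildlyRegular : MildlyRegular carrier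
  disc_subset : discG γ ⊆ carrier
  re_pos : ∀ z ∈ carrier, 0 < z.re

/-- A set of complex numbers is symmetric under conjugation if it equals its image under
complex conjugation. -/
def ConjSymmetric (S : Set ℂ) : Prop := S = (starRingEnd ℂ) '' S

namespace MoebiusDomain

variable {γ : ℝ}

/-- The closure of `H`, a compact subset of `ℂ`. -/
abbrev closed (H : MoebiusDomain γ) : Set ℂ := closure H.carrier

instance (H : MoebiusDomain γ) : CompactSpace H.closed :=
  isCompact_iff_compactSpace.mp H.isBounded.isCompact_closure

theorem re_nonneg (H : MoebiusDomain γ) {z : ℂ} (hz : z ∈ H.closed) : 0 ≤ z.re := by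
  have h : closure H.carrier ⊆ {z : ℂ | 0 ≤ z.re} :=
    closure_minimal (fun z hz => (H.re_pos z hz).le)
      (isClosed_le continuous_const Complex.continuous_re)
  exact h hz

theorem moebius_mem (hγ : 1 ≤ γ) (H : MoebiusDomain γ) {b : ℂ} (hb : γ ≤ b.re) {z : ℂ}
    (hz : z ∈ H.closed) : 1 / (z + b) ∈ H.closed := by
  have hγ0 : 0 < γ := by linarith
  have hr : (1 / (2 * γ) : ℝ) ≠ 0 := by positivity
  have hball : Metric.closedBall (((1 / (2 * γ) : ℝ) : ℂ)) (1 / (2 * γ)) ⊆ H.closed := by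
    rw [← closure_ball _ hr]
    apply closure_mono
    intro w hw
    exact H.disc_subset (by simpa [discG, dist_eq_norm] using hw)
  apply hball
  have hw : γ ≤ (z + b).re := by
    have := H.re_nonneg hz
    simp only [Complex.add_re]; linarith
  set w := z + b with hwdef
  have hw0 : w ≠ 0 := by
    intro h; rw [h] at hw; simp at hw; linarith
  rw [Metric.mem_closedBall, dist_eq_norm]
  have e : 1 / w - ((1 / (2 * γ) : ℝ) : ℂ) = ((2 * γ : ℝ) - w) / ((2 * γ : ℝ) * w) := by
    have : (γ : ℂ) ≠ 0 := by exact_mod_cast hγ0.ne'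
    push_cast
    field_simp
  rw [e, norm_div, norm_mul, Complex.norm_real, Real.norm_of_nonneg (by positivity)]
  have hn : ‖((2 * γ : ℝ) : ℂ) - w‖ ≤ ‖w‖ := by
    apply le_of_sq_le_sq _ (norm_nonneg _)
    rw [← Complex.normSq_eq_norm_sq, ← Complex.normSq_eq_norm_sq, Complex.normSq_apply,
      Complex.normSq_apply]
    simp only [Complex.sub_re, Complex.sub_im, Complex.ofReal_re, Complex.ofReal_im]
    nlinarith
  have hwn : 0 < ‖w‖ := norm_pos_iff.mpr hw0
  rw [div_le_div_iff₀ (by positivity) (by positivity)]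
  nlinarith

/-- The Möbius map `θ_b(z) = 1 / (z + b)`, as a map from the closure of `H` to itself. -/
noncomputable def theta (hγ : 1 ≤ γ) (H : MoebiusDomain γ) (b : ℂ) (hb : γ ≤ b.re)
    (z : H.closed) : H.closed :=
  ⟨1 / ((z : ℂ) + b), H.moebius_mem hγ hb z.2⟩

/-- The bounded linear map `L` of the complex Banach space `C(H̄, ℂ)` into itself is given by
`(L f)(z) = ∑_{b ∈ B} f(θ_b(z)) / |z + b|^{2s}`, the series being convergent for all `f`
and `z`. -/
def IsTransferOperator (hγ : 1 ≤ γ) (H : MoebiusDomain γ) (B : Set ℂ)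
    (hB : ∀ b ∈ B, γ ≤ b.re) (s : ℝ) (L : C(H.closed, ℂ) →L[ℂ] C(H.closed, ℂ)) : Prop :=
  ∀ (f : C(H.closed, ℂ)) (z : H.closed),
    HasSum (fun b : B => f (H.theta hγ b (hB b b.2) z) / ((‖(z : ℂ) + b‖ ^ (2 * s) : ℝ) : ℂ))
      (L f z)

/-- A real-valued continuous function, seen as a complex-valued one. -/
noncomputable def toComplex (H : MoebiusDomain γ) (u : C(H.closed, ℝ)) : C(H.closed, ℂ) :=
  ⟨fun z => (u z : ℂ), Complex.continuous_ofReal.comp u.continuous⟩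

end MoebiusDomain

/-! Everything rests on the kernels `|z + β|^(-2s)` with `Re β ≥ γ`. Since `(z + b)(θ_b(z) + β) =
β(z + b + 1/β)`, each branch of `L_s` sends a kernel to a positive multiple of another one, and `Re
(b + 1/β) ≥ γ` again. The closed convex cone generated by the kernels is therefore invariant under
`L_s` (`weightedComp_kernel`, `moebiusOp_mem_kernelCone`). An inequality `f x ≤ E * f y` satisfied
by all kernels passes to sums, nonnegative multiples and limits, so the cone inherits their Harnack
estimates.

Let `P` be the real operator. As `H̄` is compact, Harnack bounds the oscillation of `P ^ n f₀`
uniformly in `n` for a kernel `f₀`. Hence `‖P ^ n‖` is supermultiplicative up to a constant, and `P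
^ n 1` lies between two positive multiples of `r ^ n` (`exists_norm_pow_comparable`). The Cesàro
means of `r ^ (-n) P ^ n f₀` are then bounded above and away from zero and are equi-Lipschitz; by
Arzelà–Ascoli they have a limit point `v` in the cone, and telescoping gives `P v = r v`
(`exists_pos_eigenfunction`).

For uniqueness, growth forces the eigenvalue to be `r`. If `u` is another positive eigenfunction, `u
/ v` keeps its minimal value along a `θ_b`-orbit and its maximal value along another; these orbits
merge because `θ_b ∘ θ_b` is a contraction, so the quotient is constant. Symmetry of `v` follows
from uniqueness. -/

/-! ### Weighted sums of composition operators -/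

section TransferOperator

variable {X : Type*} [TopologicalSpace X] [CompactSpace X] {ι : Type*}

/-- The operator `f ↦ w * (f ∘ θ)` on continuous functions. -/
noncomputable def weightedComp (𝕜 : Type*) [RCLike 𝕜] (θ : C(X, X)) (w : C(X, ℝ)) :
    C(X, 𝕜) →L[𝕜] C(X, 𝕜) :=
  LinearMap.mkContinuous
    { toFun := fun f => ⟨fun z => (w z : 𝕜) * f (θ z), by fun_prop⟩
      map_add' := fun f g => by ext z; simp [mul_add]
      map_smul' := fun c f => by ext z; simp; ring } ‖w‖ (fun f => by
    rw [ContinuousMap.norm_le _ (by positivity)]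
    intro z
    simp only [LinearMap.coe_mk, AddHom.coe_mk, ContinuousMap.coe_mk, norm_mul]
    gcongr
    · rw [RCLike.norm_ofReal]; exact w.norm_coe_le_norm z
    · exact f.norm_coe_le_norm _)

theorem weightedComp_apply {𝕜 : Type*} [RCLike 𝕜] (θ : C(X, X)) (w : C(X, ℝ)) (f : C(X, 𝕜))
    (z : X) : weightedComp 𝕜 θ w f z = (w z : 𝕜) * f (θ z) := rfl

theorem norm_weightedComp_le {𝕜 : Type*} [RCLike 𝕜] (θ : C(X, X)) (w : C(X, ℝ)) :
    ‖weightedComp 𝕜 θ w‖ ≤ ‖w‖ :=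
  LinearMap.mkContinuous_norm_le _ (norm_nonneg _) _

/-- The transfer operator `f ↦ ∑ i, w i * (f ∘ θ i)`. -/
noncomputable def transferOp (𝕜 : Type*) [RCLike 𝕜] (θ : ι → C(X, X)) (w : ι → C(X, ℝ)) :
    C(X, 𝕜) →L[𝕜] C(X, 𝕜) :=
  ∑' i, weightedComp 𝕜 (θ i) (w i)

theorem hasSum_transferOp (𝕜 : Type*) [RCLike 𝕜] (θ : ι → C(X, X)) {w : ι → C(X, ℝ)}
    (hw : Summable fun i => ‖w i‖) (f : C(X, 𝕜)) :
    HasSum (fun i => weightedComp 𝕜 (θ i) (w i) f) (transferOp 𝕜 θ w f) := by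
  have h : Summable fun i => weightedComp 𝕜 (θ i) (w i) :=
    Summable.of_norm_bounded hw fun i => norm_weightedComp_le _ _
  exact h.hasSum.mapL (ContinuousLinearMap.apply 𝕜 C(X, 𝕜) f)

theorem hasSum_transferOp_apply (𝕜 : Type*) [RCLike 𝕜] (θ : ι → C(X, X)) {w : ι → C(X, ℝ)}
    (hw : Summable fun i => ‖w i‖) (f : C(X, 𝕜)) (z : X) :
    HasSum (fun i => (w i z : 𝕜) * f (θ i z)) (transferOp 𝕜 θ w f z) :=
  (hasSum_transferOp 𝕜 θ hw f).mapL (ContinuousMap.evalCLM 𝕜 z)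

variable {θ : ι → C(X, X)} {w : ι → C(X, ℝ)}

theorem transferOp_nonneg (hw : Summable fun i => ‖w i‖) (hw0 : ∀ i z, 0 ≤ w i z)
    (f : C(X, ℝ)) (hf : 0 ≤ f) : 0 ≤ transferOp ℝ θ w f := fun z =>
  (hasSum_transferOp_apply ℝ θ hw f z).nonneg fun i => mul_nonneg (hw0 i z) (hf _)

theorem transferOp_ofReal (hw : Summable fun i => ‖w i‖) {f : C(X, ℂ)} {u : C(X, ℝ)}
    (h : ∀ z, f z = u z) (z : X) : transferOp ℂ θ w f z = transferOp ℝ θ w u z := by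
  refine (hasSum_transferOp_apply ℂ θ hw f z).unique ?_
  have := Complex.hasSum_ofReal.mpr (hasSum_transferOp_apply ℝ θ hw u z)
  simpa [h] using this

theorem norm_transferOp_apply_le (hw : Summable fun i => ‖w i‖) (hw0 : ∀ i z, 0 ≤ w i z)
    {f : C(X, ℂ)} {u : C(X, ℝ)} (h : ∀ z, ‖f z‖ ≤ u z) (z : X) :
    ‖transferOp ℂ θ w f z‖ ≤ transferOp ℝ θ w u z := by
  have h1 := hasSum_transferOp_apply ℂ θ hw f z
  rw [← h1.tsum_eq]
  refine tsum_of_norm_bounded (hasSum_transferOp_apply ℝ θ hw u z) fun i => ?_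
  rw [norm_mul, RCLike.norm_ofReal, abs_of_nonneg (hw0 i z)]
  exact mul_le_mul_of_nonneg_left (h _) (hw0 i z)

theorem norm_transferOp_pow_apply_le (hw : Summable fun i => ‖w i‖) (hw0 : ∀ i z, 0 ≤ w i z)
    {f : C(X, ℂ)} {u : C(X, ℝ)} (h : ∀ z, ‖f z‖ ≤ u z) (n : ℕ) (z : X) :
    ‖(transferOp ℂ θ w ^ n) f z‖ ≤ (transferOp ℝ θ w ^ n) u z := by
  induction n generalizing z with
  | zero => simpa using h z
  | succ n ih =>
    simp only [pow_succ', mul_apply_eq_comp]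
    exact norm_transferOp_apply_le hw hw0 ih z

theorem transferOp_pow_ofReal (hw : Summable fun i => ‖w i‖) {f : C(X, ℂ)} {u : C(X, ℝ)}
    (h : ∀ z, f z = u z) (n : ℕ) (z : X) :
    (transferOp ℂ θ w ^ n) f z = (transferOp ℝ θ w ^ n) u z := by
  induction n generalizing z with
  | zero => simpa using h z
  | succ n ih =>
    simp only [pow_succ', mul_apply_eq_comp]
    exact transferOp_ofReal hw ih z

/-- The complex and the real transfer operators have powers of the same norm. -/
theorem norm_transferOp_pow (hw : Summable fun i => ‖w i‖) (hw0 : ∀ i z, 0 ≤ w i z) (n : ℕ) :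
    ‖transferOp ℂ θ w ^ n‖ = ‖transferOp ℝ θ w ^ n‖ := by
  apply le_antisymm
  · refine ContinuousLinearMap.opNorm_le_bound _ (norm_nonneg _) fun f => ?_
    rw [ContinuousMap.norm_le _ (by positivity)]
    intro z
    -- Nonnegative weights give `|Lⁿ f| ≤ Pⁿ |f|`. Thus the complex spectral radius can be studied
    -- on real functions, where the order lives.
    set u : C(X, ℝ) := ⟨fun z => ‖f z‖, by fun_prop⟩
    have hu : ‖u‖ ≤ ‖f‖ := by
      rw [ContinuousMap.norm_le _ (norm_nonneg _)]
      intro x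
      simpa [u] using f.norm_coe_le_norm x
    calc _ ≤ (transferOp ℝ θ w ^ n) u z :=
          norm_transferOp_pow_apply_le hw hw0 (fun _ => le_rfl) n z
      _ ≤ ‖(transferOp ℝ θ w ^ n) u‖ := ContinuousMap.apply_le_norm _ z
      _ ≤ ‖transferOp ℝ θ w ^ n‖ * ‖u‖ := ContinuousLinearMap.le_opNorm _ _
      _ ≤ _ := by gcongr
  · refine ContinuousLinearMap.opNorm_le_bound _ (norm_nonneg _) fun u => ?_
    rw [ContinuousMap.norm_le _ (by positivity)]
    intro z
    set f : C(X, ℂ) := ⟨fun z => (u z : ℂ), by fun_prop⟩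
    have hu : ‖f‖ ≤ ‖u‖ := by
      rw [ContinuousMap.norm_le _ (norm_nonneg _)]
      intro x
      simpa [f] using u.norm_coe_le_norm x
    have := transferOp_pow_ofReal (θ := θ) hw (f := f) (u := u) (fun _ => rfl) n z
    rw [← Complex.norm_real, ← this]
    calc _ ≤ ‖(transferOp ℂ θ w ^ n) f‖ := ContinuousMap.norm_coe_le_norm _ z
      _ ≤ ‖transferOp ℂ θ w ^ n‖ * ‖f‖ := ContinuousLinearMap.le_opNorm _ _
      _ ≤ _ := by gcongr

/-- The zero set of a nonnegative eigenfunction is forward invariant. -/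
theorem eq_zero_of_transferOp_eq (hw : Summable fun i => ‖w i‖) (hw0 : ∀ i z, 0 < w i z)
    {f : C(X, ℝ)} (hf : ∀ z, 0 ≤ f z) {r : ℝ} (hr : transferOp ℝ θ w f = r • f) (i : ι) {z : X}
    (hz : f z = 0) : f (θ i z) = 0 := by
  have h := hasSum_transferOp_apply ℝ θ hw f z
  rw [hr] at h
  simp only [ContinuousMap.smul_apply, hz, smul_zero] at h
  have h2 := (hasSum_zero_iff_of_nonneg fun i => mul_nonneg (hw0 i z).le (hf _)).mp h
  have := congrFun h2 i
  simpa [(hw0 i z).ne'] using this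

/-- If some branch contracts all orbits together, positive eigenfunctions for the same eigenvalue
are proportional. -/
theorem exists_smul_eq_of_transferOp_eq [Nonempty X] (hw : Summable fun i => ‖w i‖)
    (hw0 : ∀ i z, 0 < w i z) (i : ι)
    (hi : ∀ g : C(X, ℝ), ∀ x y, Tendsto (fun n => g ((θ i)^[n] x) - g ((θ i)^[n] y))
      atTop (𝓝 0))
    {u v : C(X, ℝ)} (hu : ∀ z, 0 < u z) (hv : ∀ z, 0 < v z) {r : ℝ}
    (hru : transferOp ℝ θ w u = r • u) (hrv : transferOp ℝ θ w v = r • v) :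
    ∃ c : ℝ, 0 < c ∧ u = c • v := by
  set q : C(X, ℝ) := ⟨fun z => u z / v z, u.continuous.div v.continuous fun z => (hv z).ne'⟩
  have hq : ∀ z, q z = u z / v z := fun _ => rfl
  have hqv : ∀ z, u z = q z * v z := fun z => by rw [hq, div_mul_cancel₀ _ (hv z).ne']
  obtain ⟨x, -, hx⟩ := isCompact_univ.exists_isMinOn univ_nonempty q.continuous.continuousOn
  obtain ⟨y, -, hy⟩ := isCompact_univ.exists_isMaxOn univ_nonempty q.continuous.continuousOn
  have hx' : ∀ z, q x ≤ q z := fun z => hx (mem_univ z)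
  have hy' : ∀ z, q z ≤ q y := fun z => hy (mem_univ z)
  -- By minimality of `q x`, the eigenfunction `u - q x • v` is nonnegative; it vanishes at `x`,
  -- hence along the whole orbit of `x`. The maximum is treated likewise.
  have hxn : ∀ n : ℕ, (u - q x • v) ((θ i)^[n] x) = 0 := by
    intro n
    induction n with
    | zero => simp [← hqv]
    | succ n ih =>
      rw [Function.iterate_succ_apply']
      refine eq_zero_of_transferOp_eq hw hw0 (fun z => ?_) (r := r) ?_ i ih
      · simp only [ContinuousMap.sub_apply, ContinuousMap.smul_apply, smul_eq_mul, sub_nonneg]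
        rw [hqv z]
        exact mul_le_mul_of_nonneg_right (hx' z) (hv z).le
      · rw [map_sub, map_smul, hru, hrv, smul_sub, smul_comm]
  have hyn : ∀ n : ℕ, (q y • v - u) ((θ i)^[n] y) = 0 := by
    intro n
    induction n with
    | zero => simp [← hqv]
    | succ n ih =>
      rw [Function.iterate_succ_apply']
      refine eq_zero_of_transferOp_eq hw hw0 (fun z => ?_) (r := r) ?_ i ih
      · simp only [ContinuousMap.sub_apply, ContinuousMap.smul_apply, smul_eq_mul, sub_nonneg]
        rw [hqv z]
        exact mul_le_mul_of_nonneg_right (hy' z) (hv z).le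
      · rw [map_sub, map_smul, hru, hrv, smul_sub, smul_comm]
  have h := hi q x y
  have hconst : ∀ n : ℕ, q ((θ i)^[n] x) - q ((θ i)^[n] y) = q x - q y := by
    intro n
    have h1 := hxn n
    have h2 := hyn n
    simp only [ContinuousMap.sub_apply, ContinuousMap.smul_apply, smul_eq_mul] at h1 h2
    rw [hq ((θ i)^[n] x), hq ((θ i)^[n] y), sub_eq_zero.mp h1, ← sub_eq_zero.mp h2,
      mul_div_cancel_right₀ _ (hv _).ne', mul_div_cancel_right₀ _ (hv _).ne']
  simp only [hconst] at h
  have hxy : q x = q y := sub_eq_zero.mp (tendsto_nhds_unique tendsto_const_nhds h)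
  refine ⟨q x, div_pos (hu x) (hv x), ?_⟩
  ext z
  rw [ContinuousMap.smul_apply, smul_eq_mul, hqv z,
    le_antisymm (hxy ▸ hy' z) (hx' z)]

end TransferOperator

/-! ### Positive operators with a Harnack inequality -/

section PositiveOperator

/-- A sequence that is submultiplicative, and supermultiplicative up to a constant, is comparable
with the powers of its growth rate. -/
theorem pow_le_and_le_pow_of_tendsto {a : ℕ → ℝ} {c r : ℝ} (hc : 0 < c) (ha : ∀ n, 0 < a n)
    (hsub : ∀ m n, a (m + n) ≤ a m * a n) (hsup : ∀ m n, c * (a m * a n) ≤ a (m + n))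
    (hr : Tendsto (fun k : ℕ => a k ^ (1 / (k : ℝ))) atTop (𝓝 r)) :
    0 < r ∧ ∀ n, 0 < n → r ^ n ≤ a n ∧ c * a n ≤ r ^ n := by
  -- The sequence `c * a n` is supermultiplicative, so both bounds iterate along the multiples of
  -- `n`.
  have key : ∀ n : ℕ, 0 < n → ∀ k : ℕ, 0 < k →
      a (n * k) ≤ a n ^ k ∧ (c * a n) ^ k ≤ c * a (n * k) := by
    intro n hn k hk
    induction k, hk using Nat.le_induction with
    | base => simp
    | succ k hk ih =>
      constructor
      · rw [Nat.mul_succ, pow_succ]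
        exact (hsub _ _).trans (mul_le_mul_of_nonneg_right ih.1 (ha n).le)
      · rw [Nat.mul_succ, pow_succ]
        calc _ ≤ c * a (n * k) * (c * a n) :=
              mul_le_mul_of_nonneg_right ih.2 (mul_pos hc (ha n)).le
          _ = c * (c * (a (n * k) * a n)) := by ring
          _ ≤ _ := mul_le_mul_of_nonneg_left (hsup _ _) hc.le
  have hr0 : 0 ≤ r := ge_of_tendsto' hr fun k => Real.rpow_nonneg (ha k).le _
  have hmul : ∀ n : ℕ, 0 < n → Tendsto (fun k : ℕ => n * k) atTop atTop := fun n hn =>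
    tendsto_id.const_mul_atTop' hn
  have hroot : ∀ n : ℕ, 0 < n → ∀ k : ℕ, 0 < k → ∀ x : ℝ, 0 ≤ x →
      (x ^ k) ^ (1 / ((n * k : ℕ) : ℝ)) = x ^ (1 / (n : ℝ)) := by
    intro n hn k hk x hx
    rw [← Real.rpow_natCast, ← Real.rpow_mul hx]
    congr 1
    push_cast
    field_simp
  -- The constant disappears under `k`-th roots: `c * a k` has the same growth rate as `a k`.
  have hone : Tendsto (fun k : ℕ => c ^ (1 / (k : ℝ))) atTop (𝓝 1) := by
    have := (Real.continuousAt_const_rpow hc.ne' (b := 0)).tendsto.comp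
      tendsto_one_div_atTop_nhds_zero_nat
    simpa [Function.comp_def] using this
  have hpow : ∀ n : ℕ, 0 < n → ∀ x : ℝ, 0 ≤ x → (x ^ (1 / (n : ℝ))) ^ n = x := by
    intro n hn x hx
    rw [one_div, Real.rpow_inv_natCast_pow hx hn.ne']
  have hup : ∀ n : ℕ, 0 < n → (c * a n) ^ (1 / (n : ℝ)) ≤ r := by
    intro n hn
    have h1 : Tendsto (fun k : ℕ => (c * a k) ^ (1 / (k : ℝ))) atTop (𝓝 r) := by
      have := hone.mul hr
      rw [one_mul] at this
      exact this.congr fun k => (Real.mul_rpow hc.le (ha k).le).symm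
    refine ge_of_tendsto (h1.comp (hmul n hn)) ?_
    filter_upwards [eventually_gt_atTop 0] with k hk
    rw [← hroot n hn k hk _ (mul_pos hc (ha n)).le]
    exact Real.rpow_le_rpow (pow_pos (mul_pos hc (ha n)) k).le (key n hn k hk).2 (by positivity)
  have hlow : ∀ n : ℕ, 0 < n → r ≤ a n ^ (1 / (n : ℝ)) := by
    intro n hn
    refine le_of_tendsto (hr.comp (hmul n hn)) ?_
    filter_upwards [eventually_gt_atTop 0] with k hk
    rw [← hroot n hn k hk _ (ha n).le]
    exact Real.rpow_le_rpow (ha _).le (key n hn k hk).1 (by positivity)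
  refine ⟨(Real.rpow_pos_of_pos (mul_pos hc (ha 1)) _).trans_le (hup 1 one_pos),
    fun n hn => ⟨?_, ?_⟩⟩
  · rw [← hpow n hn (a n) (ha n).le]
    exact pow_le_pow_left₀ hr0 (hlow n hn) n
  · rw [← hpow n hn (c * a n) (mul_pos hc (ha n)).le]
    exact pow_le_pow_left₀ (Real.rpow_nonneg (mul_pos hc (ha n)).le _) (hup n hn) n

/-- Bounded sets of Lipschitz functions with a common constant are compact. -/
theorem isCompact_setOf_lipschitzWith {X : Type*} [MetricSpace X] [CompactSpace X] (C : ℝ)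
    (K : NNReal) : IsCompact {f : C(X, ℝ) | ‖f‖ ≤ C ∧ LipschitzWith K f} := by
  let I := ContinuousMap.isometryEquivBoundedOfCompact X ℝ
  have hcl : IsCompact {f : BoundedContinuousFunction X ℝ | ‖f‖ ≤ C ∧ LipschitzWith K f} := by
    refine BoundedContinuousFunction.arzela_ascoli₂ (Metric.closedBall (0 : ℝ) C)
      (isCompact_closedBall 0 C) _ ?_ ?_ ?_
    · apply IsClosed.inter
      · exact isClosed_le continuous_norm continuous_const
      · have : {f : BoundedContinuousFunction X ℝ | LipschitzWith K f} =
            ⋂ x, ⋂ y, {f | dist (f x) (f y) ≤ K * dist x y} := by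
          ext f; simp [lipschitzWith_iff_dist_le_mul]
        change IsClosed {f : BoundedContinuousFunction X ℝ | LipschitzWith K f}
        rw [this]
        refine isClosed_iInter fun x => isClosed_iInter fun y => isClosed_le ?_ continuous_const
        fun_prop
    · intro f x hf
      rw [mem_closedBall_zero_iff]
      exact (f.norm_coe_le_norm x).trans hf.1
    · exact LipschitzWith.uniformEquicontinuous _ K (fun f => f.2.2) |>.equicontinuous
  have := hcl.image I.symm.continuous
  have heq : I.symm '' {f | ‖f‖ ≤ C ∧ LipschitzWith K f} =
      {f : C(X, ℝ) | ‖f‖ ≤ C ∧ LipschitzWith K f} := by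
    ext f
    constructor
    · rintro ⟨g, hg, rfl⟩
      exact ⟨by simpa [I] using hg.1, hg.2⟩
    · intro hf
      exact ⟨I f, ⟨hf.1, hf.2⟩, I.symm_apply_apply f⟩
  rwa [heq] at this

variable {X : Type*} [MetricSpace X] [CompactSpace X]

theorem positive_pow {P : C(X, ℝ) →L[ℝ] C(X, ℝ)} (hP : ∀ f, 0 ≤ f → 0 ≤ P f) (n : ℕ)
    {f g : C(X, ℝ)} (h : f ≤ g) (z : X) : (P ^ n) f z ≤ (P ^ n) g z := by
  have key : ∀ f, 0 ≤ f → 0 ≤ (P ^ n) f := by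
    induction n with
    | zero => simp
    | succ n ih =>
      intro f hf
      rw [pow_succ', mul_apply_eq_comp]
      exact hP _ (ih f hf)
  have := key (g - f) (sub_nonneg.mpr h) z
  simpa using this

/-- Positivity applied to `-‖f‖ ≤ f ≤ ‖f‖`: the constant function realises the norm. -/
theorem norm_pow_le_norm_pow_one {P : C(X, ℝ) →L[ℝ] C(X, ℝ)} (hP : ∀ f, 0 ≤ f → 0 ≤ P f)
    (n : ℕ) : ‖P ^ n‖ ≤ ‖(P ^ n) 1‖ := by
  refine ContinuousLinearMap.opNorm_le_bound _ (norm_nonneg _) fun f => ?_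
  rw [ContinuousMap.norm_le _ (by positivity)]
  intro z
  have h1 : (P ^ n) f z ≤ ‖f‖ * (P ^ n) 1 z := by
    have := positive_pow hP n (f := f) (g := ‖f‖ • 1)
      (fun x => by simpa using ContinuousMap.apply_le_norm f x) z
    simpa using this
  have h2 : -(‖f‖ * (P ^ n) 1 z) ≤ (P ^ n) f z := by
    have := positive_pow hP n (f := (-‖f‖) • 1) (g := f)
      (fun x => by simpa using ContinuousMap.neg_norm_le_apply f x) z
    simpa only [map_smul, ContinuousMap.smul_apply, smul_eq_mul, neg_mul] using this
  have h3 : (P ^ n) 1 z ≤ ‖(P ^ n) 1‖ := ContinuousMap.apply_le_norm _ z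
  rw [Real.norm_eq_abs, mul_comm]
  exact (abs_le.mpr ⟨h2, h1⟩).trans (mul_le_mul_of_nonneg_left h3 (norm_nonneg _))

/-- The elementary bound `e^t ≤ 1 + t e^t` turns a multiplicative Harnack estimate into an additive
one. The constant depends on `f` only through its bound `C`, as equicontinuity requires. -/
theorem lipschitzWith_of_le_mul_exp {f : C(X, ℝ)} (h0 : ∀ x, 0 ≤ f x) {A C D : ℝ} (hA : 0 ≤ A)
    (hC : 0 ≤ C) (hfC : ‖f‖ ≤ C) (hD : ∀ x y : X, dist x y ≤ D)
    (h : ∀ x y, f x ≤ f y * Real.exp (A * dist x y)) :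
    LipschitzWith (C * (A * Real.exp (A * D))).toNNReal f := by
  refine LipschitzWith.of_le_add_mul _ fun x y => ?_
  rw [Real.coe_toNNReal _ (by positivity)]
  have hd := hD x y
  set t := A * dist x y
  have ht : 0 ≤ t := by positivity
  have h1 : Real.exp t ≤ 1 + t * Real.exp t := by
    have := Real.add_one_le_exp (-t)
    have h2 : Real.exp (-t) * Real.exp t = 1 := by rw [← Real.exp_add]; simp
    nlinarith [Real.exp_pos t]
  have h2 : Real.exp t ≤ Real.exp (A * D) := by
    exact Real.exp_le_exp.mpr (mul_le_mul_of_nonneg_left hd hA)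
  calc f x ≤ f y * Real.exp t := h x y
    _ ≤ f y * (1 + t * Real.exp (A * D)) := by
        refine mul_le_mul_of_nonneg_left (h1.trans ?_) (h0 y)
        gcongr
    _ = f y + f y * (t * Real.exp (A * D)) := by ring
    _ ≤ f y + C * (t * Real.exp (A * D)) := by
        gcongr
        exact (ContinuousMap.apply_le_norm f y).trans hfC
    _ = _ := by simp only [t]; ring

/-- A positive operator has powers `P ^ n 1` bounded below by a multiple of `‖P ^ n‖` if some
positive function has an orbit satisfying a Harnack inequality. -/
theorem exists_mul_norm_pow_le [Nonempty X] {P : C(X, ℝ) →L[ℝ] C(X, ℝ)}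
    (hP : ∀ f, 0 ≤ f → 0 ≤ P f) {f₀ : C(X, ℝ)} (hf₀ : ∀ x, 0 < f₀ x) {E : ℝ} (hE : 0 < E)
    (hH : ∀ n x y, (P ^ n) f₀ x ≤ E * (P ^ n) f₀ y) :
    ∃ c : ℝ, 0 < c ∧ ∀ n z, c * ‖P ^ n‖ ≤ (P ^ n) 1 z := by
  obtain ⟨x₀, -, hx₀⟩ := isCompact_univ.exists_isMinOn univ_nonempty f₀.continuous.continuousOn
  have hm : ∀ z, f₀ x₀ ≤ f₀ z := fun z => hx₀ (mem_univ z)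
  have hM : 0 < ‖f₀‖ := (hf₀ x₀).trans_le (ContinuousMap.apply_le_norm _ _)
  -- With `m = f₀ x₀` the minimum, `m ≤ f₀ ≤ ‖f₀‖` transfers the Harnack constant `E` from `P ^ n
  -- f₀` to `P ^ n 1` at the cost of a factor `‖f₀‖ / m`.
  refine ⟨f₀ x₀ / (E * ‖f₀‖), div_pos (hf₀ x₀) (mul_pos hE hM), fun n z => ?_⟩
  rw [div_mul_eq_mul_div, div_le_iff₀ (mul_pos hE hM)]
  have h1 : (P ^ n) f₀ z ≤ ‖f₀‖ * (P ^ n) 1 z := by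
    have := positive_pow hP n (f := f₀) (g := ‖f₀‖ • 1)
      (fun x => by simpa using ContinuousMap.apply_le_norm f₀ x) z
    simpa using this
  have h2 : ∀ y, f₀ x₀ * (P ^ n) 1 y ≤ (P ^ n) f₀ y := fun y => by
    have := positive_pow hP n (f := f₀ x₀ • 1) (g := f₀) (fun x => by simpa using hm x) y
    simpa using this
  have h0 : ∀ y, 0 ≤ (P ^ n) 1 y := fun y => by
    have := positive_pow hP n (f := 0) (g := 1) (fun x => by simp) y
    simpa using this
  have h3 : ‖(P ^ n) 1‖ ≤ E * ‖f₀‖ * (P ^ n) 1 z / f₀ x₀ := by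
    have hb : ∀ y, (P ^ n) 1 y ≤ E * ‖f₀‖ * (P ^ n) 1 z / f₀ x₀ := fun y => by
      rw [le_div_iff₀ (hf₀ x₀), mul_comm]
      calc _ ≤ (P ^ n) f₀ y := h2 y
        _ ≤ E * (P ^ n) f₀ z := hH n y z
        _ ≤ E * (‖f₀‖ * (P ^ n) 1 z) := mul_le_mul_of_nonneg_left h1 hE.le
        _ = _ := by ring
    rw [ContinuousMap.norm_le _ ((h0 z).trans (hb z))]
    intro y
    rw [Real.norm_eq_abs, abs_of_nonneg (h0 y)]
    exact hb y
  rw [le_div_iff₀ (hf₀ x₀)] at h3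
  calc _ ≤ f₀ x₀ * ‖(P ^ n) 1‖ := by
        gcongr
        · exact (hf₀ x₀).le
        · exact norm_pow_le_norm_pow_one hP n
    _ ≤ _ := by linarith

/-- Under the same assumptions the powers of `P` grow exactly like those of its spectral radius. -/
theorem exists_norm_pow_comparable [Nonempty X] {P : C(X, ℝ) →L[ℝ] C(X, ℝ)}
    (hP : ∀ f, 0 ≤ f → 0 ≤ P f) (hP1 : ∀ z, 0 < P 1 z) {f₀ : C(X, ℝ)} (hf₀ : ∀ x, 0 < f₀ x)
    {E : ℝ} (hE : 0 < E) (hH : ∀ n x y, (P ^ n) f₀ x ≤ E * (P ^ n) f₀ y) {r : ℝ}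
    (hr : Tendsto (fun k : ℕ => ‖P ^ k‖ ^ (1 / (k : ℝ))) atTop (𝓝 r)) :
    0 < r ∧ ∃ c C : ℝ, 0 < c ∧ 0 < C ∧ ∀ n z, c * r ^ n ≤ (P ^ n) 1 z ∧ (P ^ n) 1 z ≤ C * r ^ n := by
  obtain ⟨c, hc, hcn⟩ := exists_mul_norm_pow_le hP hf₀ hE hH
  obtain ⟨x₀⟩ := ‹Nonempty X›
  have hpos : ∀ n z, 0 < (P ^ n) 1 z := by
    intro n
    induction n with
    | zero => simp
    | succ n ih =>
      obtain ⟨x₁, -, hx₁⟩ := isCompact_univ.exists_isMinOn ⟨x₀, mem_univ x₀⟩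
        ((P ^ n) 1).continuous.continuousOn
      intro z
      have := positive_pow hP 1 (f := (P ^ n) 1 x₁ • 1) (g := (P ^ n) 1)
        (fun x => by simpa using hx₁ (mem_univ x)) z
      rw [pow_succ', mul_apply_eq_comp]
      simp only [pow_one, map_smul, ContinuousMap.smul_apply, smul_eq_mul] at this
      exact (mul_pos (ih x₁) (hP1 z)).trans_le this
  have hle : ∀ n z, (P ^ n) 1 z ≤ ‖P ^ n‖ := fun n z => by
    have : Nonempty X := ⟨x₀⟩
    have h1 : ‖(1 : C(X, ℝ))‖ = 1 := norm_one
    calc _ ≤ ‖(P ^ n) 1‖ := ContinuousMap.apply_le_norm _ z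
      _ ≤ ‖P ^ n‖ * ‖(1 : C(X, ℝ))‖ := ContinuousLinearMap.le_opNorm _ _
      _ = _ := by rw [h1, mul_one]
  have ha : ∀ n, 0 < ‖P ^ n‖ := fun n => (hpos n x₀).trans_le (hle n x₀)
  -- Apply `P ^ m` to `P ^ n 1 ≥ c ‖P ^ n‖`, then bound `P ^ m 1` from below in the same way.
  have hsup : ∀ m n, c ^ 2 * (‖P ^ m‖ * ‖P ^ n‖) ≤ ‖P ^ (m + n)‖ := by
    intro m n
    have h1 := positive_pow hP m (f := (c * ‖P ^ n‖) • 1) (g := (P ^ n) 1)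
      (fun x => by simpa using hcn n x) x₀
    rw [← mul_apply_eq_comp, ← pow_add] at h1
    simp only [map_smul, ContinuousMap.smul_apply, smul_eq_mul] at h1
    calc _ = (c * ‖P ^ n‖) * (c * ‖P ^ m‖) := by ring
      _ ≤ (c * ‖P ^ n‖) * (P ^ m) 1 x₀ :=
          mul_le_mul_of_nonneg_left (hcn m x₀) (mul_pos hc (ha n)).le
      _ ≤ _ := h1.trans (hle _ _)
  obtain ⟨hr0, hb⟩ := pow_le_and_le_pow_of_tendsto (pow_pos hc 2) ha
    (fun m n => by rw [pow_add]; exact norm_mul_le (P ^ m) (P ^ n)) hsup hr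
  -- The comparison with `r ^ n` is known for `n > 0`; the `min` and `max` with `1` take care of `n
  -- = 0`.
  refine ⟨hr0, min c 1, max (1 / c ^ 2) 1, by positivity, by positivity, fun n z => ?_⟩
  rcases Nat.eq_zero_or_pos n with rfl | hn
  · simp
  obtain ⟨h1, h2⟩ := hb n hn
  constructor
  · calc min c 1 * r ^ n ≤ c * ‖P ^ n‖ := by gcongr; exact min_le_left _ _
      _ ≤ _ := hcn n z
  · calc (P ^ n) 1 z ≤ ‖P ^ n‖ := hle n z
      _ ≤ 1 / c ^ 2 * r ^ n := by
          rw [one_div, inv_mul_eq_div, le_div_iff₀ (by positivity)]; linarith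
      _ ≤ _ := by gcongr; exact le_max_left _ _

/-- A positive eigenfunction can only belong to the growth rate of the powers. -/
theorem eigenvalue_eq_of_comparable [Nonempty X] {P : C(X, ℝ) →L[ℝ] C(X, ℝ)}
    (hP : ∀ f, 0 ≤ f → 0 ≤ P f) {r c C : ℝ} (hr : 0 < r) (hc : 0 < c)
    (hcC : ∀ n z, c * r ^ n ≤ (P ^ n) 1 z ∧ (P ^ n) 1 z ≤ C * r ^ n)
    {u : C(X, ℝ)} (hu : ∀ z, 0 < u z) {μ : ℝ} (hμ : 0 < μ) (hPu : P u = μ • u) : μ = r := by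
  obtain ⟨x₀, -, hx₀⟩ := isCompact_univ.exists_isMinOn univ_nonempty u.continuous.continuousOn
  have hm : ∀ z, u x₀ ≤ u z := fun z => hx₀ (mem_univ z)
  have hM : 0 < ‖u‖ := (hu x₀).trans_le (ContinuousMap.apply_le_norm _ _)
  have hpow : ∀ n, (P ^ n) u = μ ^ n • u := by
    intro n
    induction n with
    | zero => simp
    | succ n ih => rw [pow_succ', mul_apply_eq_comp, ih, map_smul, hPu, smul_smul,
        ← pow_succ]
  have hup : ∀ n, μ ^ n * u x₀ ≤ ‖u‖ * (C * r ^ n) := fun n => by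
    have := positive_pow hP n (f := u) (g := ‖u‖ • 1)
      (fun x => by simpa using ContinuousMap.apply_le_norm u x) x₀
    rw [hpow] at this
    simp only [map_smul, ContinuousMap.smul_apply, smul_eq_mul] at this
    exact this.trans (mul_le_mul_of_nonneg_left (hcC n x₀).2 hM.le)
  have hlow : ∀ n, u x₀ * (c * r ^ n) ≤ μ ^ n * u x₀ := fun n => by
    have := positive_pow hP n (f := u x₀ • 1) (g := u) (fun x => by simpa using hm x) x₀
    rw [hpow] at this
    simp only [map_smul, ContinuousMap.smul_apply, smul_eq_mul] at this
    exact (mul_le_mul_of_nonneg_left (hcC n x₀).1 (hu x₀).le).trans this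
  -- `μ ^ n` and `r ^ n` bound each other up to constant factors, and a geometric sequence dominated
  -- by a multiple of another has the smaller ratio.
  have key : ∀ {p q K : ℝ}, 0 < q → (∀ n : ℕ, p ^ n ≤ K * q ^ n) → p ≤ q := by
    intro p q K hq h
    by_contra hlt
    rw [not_le] at hlt
    have h1 : 1 < p / q := (one_lt_div hq).mpr hlt
    obtain ⟨n, hn⟩ := pow_unbounded_of_one_lt K h1
    rw [div_pow, lt_div_iff₀ (pow_pos hq n)] at hn
    exact absurd (h n) (not_le.mpr hn)
  apply le_antisymm
  · refine key (K := ‖u‖ * C / u x₀) hr fun n => ?_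
    rw [div_mul_eq_mul_div, le_div_iff₀ (hu x₀)]
    linarith [hup n]
  · refine key (K := 1 / c) hμ fun n => ?_
    rw [one_div, inv_mul_eq_div, le_div_iff₀ hc]
    have := hlow n
    rw [mul_comm (μ ^ n)] at this
    linarith [le_of_mul_le_mul_left this (hu x₀)]

/-- Existence of a positive eigenfunction in an invariant closed cone of functions satisfying a
Harnack inequality. -/
theorem exists_pos_eigenfunction [Nonempty X] {P : C(X, ℝ) →L[ℝ] C(X, ℝ)}
    (hP : ∀ f, 0 ≤ f → 0 ≤ P f) {r c C : ℝ} (hr : 0 < r) (hc : 0 < c)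
    (hcC : ∀ n z, c * r ^ n ≤ (P ^ n) 1 z ∧ (P ^ n) 1 z ≤ C * r ^ n)
    (K : Submodule NNReal C(X, ℝ)) (hK : IsClosed (K : Set C(X, ℝ))) (hPK : ∀ f ∈ K, P f ∈ K)
    (hK0 : ∀ f ∈ K, ∀ x, 0 ≤ f x) {A : ℝ} (hA : 0 ≤ A)
    (hKA : ∀ f ∈ K, ∀ x y, f x ≤ f y * Real.exp (A * dist x y))
    {f₀ : C(X, ℝ)} (hf₀K : f₀ ∈ K) (hf₀ : ∀ x, 0 < f₀ x) :
    ∃ v ∈ K, (∀ x, 0 < v x) ∧ P v = r • v ∧ ∃ L : NNReal, LipschitzWith L v := by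
  obtain ⟨x₀, -, hx₀⟩ := isCompact_univ.exists_isMinOn univ_nonempty f₀.continuous.continuousOn
  have hm : ∀ z, f₀ x₀ ≤ f₀ z := fun z => hx₀ (mem_univ z)
  have hM : 0 < ‖f₀‖ := (hf₀ x₀).trans_le (ContinuousMap.apply_le_norm _ _)
  have hC : 0 ≤ C := by
    have h := hcC 0 x₀
    simp at h
    linarith [h.2]
  obtain ⟨D, hD⟩ : ∃ D, ∀ x y : X, dist x y ≤ D :=
    ⟨Metric.diam (univ : Set X), fun x y => Metric.dist_le_diam_of_mem
      isCompact_univ.isBounded (mem_univ x) (mem_univ y)⟩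
  have hPn : ∀ n, (P ^ n) f₀ ∈ K := by
    intro n
    induction n with
    | zero => simpa using hf₀K
    | succ n ih => rw [pow_succ', mul_apply_eq_comp]; exact hPK _ ih
  set g : ℕ → C(X, ℝ) := fun n => (r ^ n)⁻¹ • (P ^ n) f₀ with hg
  have hgK : ∀ n, g n ∈ K := fun n =>
    K.smul_mem (⟨(r ^ n)⁻¹, by positivity⟩ : NNReal) (hPn n)
  have hgup : ∀ n z, g n z ≤ ‖f₀‖ * C := fun n z => by
    have h1 := positive_pow hP n (f := f₀) (g := ‖f₀‖ • 1)
      (fun x => by simpa using ContinuousMap.apply_le_norm f₀ x) z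
    simp only [map_smul, ContinuousMap.smul_apply, smul_eq_mul] at h1
    simp only [hg, ContinuousMap.smul_apply, smul_eq_mul]
    rw [inv_mul_le_iff₀ (pow_pos hr n)]
    calc _ ≤ _ := h1
      _ ≤ ‖f₀‖ * (C * r ^ n) := mul_le_mul_of_nonneg_left (hcC n z).2 hM.le
      _ = _ := by ring
  have hglow : ∀ n z, f₀ x₀ * c ≤ g n z := fun n z => by
    have h1 := positive_pow hP n (f := f₀ x₀ • 1) (g := f₀) (fun x => by simpa using hm x) z
    simp only [map_smul, ContinuousMap.smul_apply, smul_eq_mul] at h1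
    simp only [hg, ContinuousMap.smul_apply, smul_eq_mul]
    rw [le_inv_mul_iff₀ (pow_pos hr n)]
    calc _ = f₀ x₀ * (c * r ^ n) := by ring
      _ ≤ _ := mul_le_mul_of_nonneg_left (hcC n z).1 (hf₀ x₀).le
      _ ≤ _ := h1
  have hPg : ∀ n, P (g n) = r • g (n + 1) := fun n => by
    simp only [hg, map_smul]
    rw [← mul_apply_eq_comp, ← pow_succ', smul_smul]
    congr 1
    rw [pow_succ]
    field_simp
  -- The normalised iterates need not converge. Their averages stay in the cone, and `P (v N) - r •
  -- v N` telescopes to a term of order `1 / N`.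
  set v : ℕ → C(X, ℝ) := fun N => ((N : ℝ) + 1)⁻¹ • ∑ n ∈ Finset.range (N + 1), g n with hv
  have hvK : ∀ N, v N ∈ K := fun N =>
    K.smul_mem (⟨((N : ℝ) + 1)⁻¹, by positivity⟩ : NNReal) (K.sum_mem fun n _ => hgK n)
  have hvapp : ∀ N z, v N z = ((N : ℝ) + 1)⁻¹ * ∑ n ∈ Finset.range (N + 1), g n z := fun N z => by
    simp [hv]
  have hvup : ∀ N z, v N z ≤ ‖f₀‖ * C := fun N z => by
    rw [hvapp, inv_mul_le_iff₀ (by positivity)]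
    have := Finset.sum_le_card_nsmul (Finset.range (N + 1)) (fun n => g n z) _
      (fun n _ => hgup n z)
    simpa using this
  have hvlow : ∀ N z, f₀ x₀ * c ≤ v N z := fun N z => by
    rw [hvapp, le_inv_mul_iff₀ (by positivity)]
    have := Finset.card_nsmul_le_sum (Finset.range (N + 1)) (fun n => g n z) _
      (fun n _ => hglow n z)
    simpa using this
  have hvnorm : ∀ N, ‖v N‖ ≤ ‖f₀‖ * C := fun N => by
    rw [ContinuousMap.norm_le _ (by positivity)]
    intro z
    rw [Real.norm_eq_abs, abs_of_nonneg (hK0 _ (hvK N) z)]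
    exact hvup N z
  have hvres : ∀ N, P (v N) - r • v N = (r * ((N : ℝ) + 1)⁻¹) • (g (N + 1) - f₀) := fun N => by
    have hsum := Finset.sum_range_succ_sub_sum g (n := N + 1)
    have h1 := Finset.sum_range_succ' g (N + 1)
    have h2 := Finset.sum_range_succ g (N + 1)
    have h0 : g 0 = f₀ := by simp [hg]
    have h3 : ∑ n ∈ Finset.range (N + 1), g (n + 1) - ∑ n ∈ Finset.range (N + 1), g n
        = g (N + 1) - f₀ := by
      rw [sub_eq_sub_iff_add_eq_add, ← h0, ← h1, h2, add_comm]
    simp only [hv, map_smul, map_sum, hPg]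
    rw [← h3, ← Finset.smul_sum, smul_smul, smul_smul, smul_sub, mul_comm]
  have hlim0 : Tendsto (fun N => P (v N) - r • v N) atTop (𝓝 0) := by
    have hz : Tendsto (fun N : ℕ => r * ((N : ℝ) + 1)⁻¹ * (‖f₀‖ * C + ‖f₀‖)) atTop (𝓝 0) := by
      have := ((tendsto_one_div_add_atTop_nhds_zero_nat (𝕜 := ℝ)).const_mul r).mul_const
        (‖f₀‖ * C + ‖f₀‖)
      simpa using this
    refine squeeze_zero_norm (fun N => ?_) hz
    rw [hvres, norm_smul, Real.norm_of_nonneg (by positivity)]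
    gcongr
    refine (norm_sub_le _ _).trans ?_
    gcongr
    rw [ContinuousMap.norm_le _ (by positivity)]
    intro z
    rw [Real.norm_eq_abs, abs_of_nonneg (hK0 _ (hgK _) z)]
    exact hgup _ z
  obtain ⟨w, hw, φ, hφ, hlim⟩ := (isCompact_setOf_lipschitzWith (X := X) (‖f₀‖ * C)
    (‖f₀‖ * C * (A * Real.exp (A * D))).toNNReal).tendsto_subseq (x := v) fun N =>
      ⟨hvnorm N, lipschitzWith_of_le_mul_exp (hK0 _ (hvK N)) hA (by positivity) (hvnorm N) hD
        (hKA _ (hvK N))⟩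
  refine ⟨w, hK.mem_of_tendsto hlim (Eventually.of_forall fun N => hvK _), fun x => ?_, ?_, _, hw.2⟩
  · have : Tendsto (fun N => v (φ N) x) atTop (𝓝 (w x)) :=
      ((ContinuousMap.evalCLM ℝ x).continuous.tendsto w).comp hlim
    exact (mul_pos (hf₀ x₀) hc).trans_le (ge_of_tendsto' this fun N => hvlow _ x)
  · have h1 : Tendsto (fun N => P (v (φ N)) - r • v (φ N)) atTop (𝓝 (P w - r • w)) :=
      ((P.continuous.tendsto w).comp hlim).sub (hlim.const_smul r)
    exact sub_eq_zero.mp (tendsto_nhds_unique h1 (hlim0.comp hφ.tendsto_atTop))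

end PositiveOperator

/-! ### Growth of `|z + β|` on the right half-plane -/

section Kernel

theorem norm_pos_of_re_pos {w : ℂ} (hw : 0 < w.re) : 0 < ‖w‖ :=
  hw.trans_le (Complex.re_le_norm w)

/-- `|z + β|` grows at most like `exp (|z' - z| / γ)` on the right half-plane. -/
theorem norm_add_le_mul_exp {γ : ℝ} (hγ : 0 < γ) {z z' β : ℂ} (hz : 0 ≤ z.re) (hβ : γ ≤ β.re) :
    ‖z' + β‖ ≤ ‖z + β‖ * Real.exp (‖z' - z‖ / γ) := by
  have h1 : γ ≤ ‖z + β‖ := by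
    refine le_trans ?_ (Complex.re_le_norm _)
    simp only [Complex.add_re]; linarith
  have h2 : ‖z' + β‖ ≤ ‖z + β‖ + ‖z' - z‖ := by
    have := norm_add_le (z + β) (z' - z)
    rwa [show z + β + (z' - z) = z' + β by ring] at this
  have h3 := Real.add_one_le_exp (‖z' - z‖ / γ)
  have h4 : ‖z' - z‖ ≤ ‖z + β‖ * (‖z' - z‖ / γ) := by
    rw [mul_div_assoc', le_div_iff₀ hγ, mul_comm]
    gcongr
  calc _ ≤ ‖z + β‖ * (‖z' - z‖ / γ + 1) := by linarith
    _ ≤ _ := by gcongr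

/-- The logarithmic derivative `2y / (1 + y²)` is at most `1`. This is the source of the halved rate
in the vertical direction. -/
theorem one_add_sq_le_mul_exp (y t : ℝ) (ht : 0 ≤ t) :
    1 + (y + t) ^ 2 ≤ (1 + y ^ 2) * Real.exp t := by
  have h : 1 + t + t ^ 2 / 2 + t ^ 3 / 6 ≤ Real.exp t := by
    have := Real.sum_le_exp_of_nonneg ht 4
    simpa [Finset.sum_range_succ, Nat.factorial] using this
  refine le_trans ?_ (mul_le_mul_of_nonneg_left h (by positivity))
  -- The difference of the two sides is `t` times this quadratic in `t`, whose discriminant is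
  -- nonpositive as `(1 + y)² ≤ 2(1 + y²)`. The cubic Taylor term supplies the coefficient of `t²`.
  have key : 0 ≤ (1 - y) ^ 2 - t * (1 - y) * (1 + y) / 2 + (1 + y ^ 2) * t ^ 2 / 6 := by
    nlinarith [sq_nonneg ((1 - y) - t * (1 + y) / 4), mul_nonneg (sq_nonneg t) (sq_nonneg (1 - y)),
      mul_nonneg (sq_nonneg t) (sq_nonneg y), sq_nonneg t]
  nlinarith [mul_nonneg ht key]

/-- Along vertical lines the growth rate of `|z + β|` is only half as large. -/
theorem norm_add_le_mul_exp_of_re_eq {γ : ℝ} (hγ : 0 < γ) {z z' β : ℂ} (hz : 0 ≤ z.re)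
    (hzz : z.re = z'.re) (hβ : γ ≤ β.re) :
    ‖z' + β‖ ≤ ‖z + β‖ * Real.exp (|z'.im - z.im| / (2 * γ)) := by
  have hX : 0 < z.re + β.re := by linarith
  set X := z.re + β.re with hXdef
  set Y := z.im + β.im with hYdef
  set d := z'.im - z.im with hd
  have hexp : Real.exp (|d| / (2 * γ)) ^ 2 = Real.exp (|d| / γ) := by
    rw [← Real.exp_nat_mul]; congr 1; push_cast; field_simp
  apply le_of_sq_le_sq _ (by positivity)
  rw [mul_pow, hexp, ← Complex.normSq_eq_norm_sq, ← Complex.normSq_eq_norm_sq,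
    Complex.normSq_apply, Complex.normSq_apply]
  simp only [Complex.add_re, Complex.add_im, ← hzz]
  rw [← hXdef, ← hYdef, show z'.im + β.im = Y + d by rw [hd, hYdef]; ring]
  -- Scaling by `X` reduces to real part `1`; `X ≥ γ` then gives the rate.
  have h1 := one_add_sq_le_mul_exp (|Y| / X) (|d| / X) (by positivity)
  have h2 : Real.exp (|d| / X) ≤ Real.exp (|d| / γ) := by
    apply Real.exp_le_exp.mpr
    gcongr
    linarith
  have h3 : (Y + d) ^ 2 ≤ (|Y| + |d|) ^ 2 := by
    rw [← sq_abs (Y + d)]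
    gcongr
    exact abs_add_le _ _
  have h4 : X * X + (|Y| + |d|) ^ 2 = X ^ 2 * (1 + (|Y| / X + |d| / X) ^ 2) := by
    field_simp
  have h5 : X * X + Y * Y = X ^ 2 * (1 + (|Y| / X) ^ 2) := by
    rw [div_pow, sq_abs]; field_simp
  calc X * X + (Y + d) * (Y + d) ≤ X * X + (|Y| + |d|) ^ 2 := by nlinarith
    _ ≤ X ^ 2 * ((1 + (|Y| / X) ^ 2) * Real.exp (|d| / X)) := by rw [h4]; gcongr
    _ = (X * X + Y * Y) * Real.exp (|d| / X) := by rw [h5]; ring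
    _ ≤ _ := by
        gcongr
        nlinarith

theorem rpow_neg_le_mul_exp {a b t s : ℝ} (ha : 0 < a) (hb : 0 < b) (hs : 0 ≤ s)
    (h : b ≤ a * Real.exp t) : a ^ (-s) ≤ b ^ (-s) * Real.exp (s * t) := by
  rw [Real.rpow_neg ha.le, Real.rpow_neg hb.le, inv_mul_eq_div, le_div_iff₀ (by positivity),
    inv_mul_le_iff₀ (by positivity)]
  calc b ^ s ≤ (a * Real.exp t) ^ s := Real.rpow_le_rpow hb.le h hs
    _ = _ := by rw [Real.mul_rpow ha.le (Real.exp_pos _).le, ← Real.exp_mul, mul_comm t]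

/-- Comparison of `|z + b|` with `|b|` on bounded subsets of the right half-plane. -/
theorem norm_le_one_add_mul_norm_add {γ R : ℝ} (hγ : 1 ≤ γ) {z b : ℂ} (hz : 0 ≤ z.re) (hb : γ ≤ b.re)
    (hR : ‖z‖ ≤ R) : ‖b‖ ≤ (1 + R) * ‖z + b‖ := by
  have h1 : 1 ≤ ‖z + b‖ := by
    refine le_trans ?_ (Complex.re_le_norm _)
    simp only [Complex.add_re]; linarith
  have h2 : ‖b‖ ≤ ‖z + b‖ + ‖z‖ := by
    have := norm_sub_le (z + b) z
    rwa [add_sub_cancel_left] at this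
  nlinarith [norm_nonneg z]

/-- Writing `1 + bw = w(b + 1/w)`, the second factor has real part at least `1 + 1/|w|²`, and `|w| +
1/|w| ≥ 2`. With `w = z + b` this is the denominator of `θ_b ∘ θ_b`. -/
theorem two_le_norm_one_add_mul {b w : ℂ} (hb : 1 ≤ b.re) (hw : 1 ≤ w.re) : 2 ≤ ‖1 + b * w‖ := by
  have hw0 : 0 < ‖w‖ := norm_pos_of_re_pos (by linarith)
  have hwne : w ≠ 0 := norm_pos_iff.mp hw0
  have h1 : 1 + b * w = w * (b + w⁻¹) := by field_simp; ring
  have h2 : 1 + 1 / ‖w‖ ^ 2 ≤ ‖b + w⁻¹‖ := by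
    refine le_trans ?_ (Complex.re_le_norm _)
    rw [Complex.add_re, Complex.inv_re, Complex.normSq_eq_norm_sq]
    gcongr
  rw [h1, norm_mul]
  calc 2 ≤ ‖w‖ * (1 + 1 / ‖w‖ ^ 2) := by
        rw [show ‖w‖ * (1 + 1 / ‖w‖ ^ 2) = (‖w‖ ^ 2 + 1) / ‖w‖ by field_simp,
          le_div_iff₀ hw0]
        nlinarith [sq_nonneg (‖w‖ - 1)]
    _ ≤ _ := by gcongr

end Kernel

/-! ### The cone of kernels and its invariance -/

namespace MoebiusDomain

variable {γ : ℝ}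

theorem nonempty_closed (hγ : 1 ≤ γ) (H : MoebiusDomain γ) : Nonempty H.closed := by
  refine ⟨⟨((1 / (2 * γ) : ℝ) : ℂ), subset_closure (H.disc_subset ?_)⟩⟩
  have : 0 < 1 / (2 * γ) := by positivity
  simpa only [discG, mem_ofPred_eq, sub_self, norm_zero] using this

theorem exists_norm_le (H : MoebiusDomain γ) : ∃ R : ℝ, 0 ≤ R ∧ ∀ z : H.closed, ‖(z : ℂ)‖ ≤ R := by
  obtain ⟨R, hR⟩ := H.isBounded.closure.exists_norm_le
  exact ⟨max R 0, le_max_right _ _, fun z => (hR z z.2).trans (le_max_left _ _)⟩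

theorem norm_add_pos (hγ : 1 ≤ γ) (H : MoebiusDomain γ) {b : ℂ} (hb : γ ≤ b.re) (z : H.closed) :
    0 < ‖(z : ℂ) + b‖ := by
  apply norm_pos_of_re_pos
  have := H.re_nonneg z.2
  simp only [Complex.add_re]; linarith

/-- `θ_b` as a continuous map. -/
noncomputable def thetaMap (hγ : 1 ≤ γ) (H : MoebiusDomain γ) (b : ℂ) (hb : γ ≤ b.re) :
    C(H.closed, H.closed) :=
  ⟨H.theta hγ b hb, Continuous.subtype_mk (continuous_const.div (by fun_prop) fun z =>
    norm_pos_iff.mp (H.norm_add_pos hγ hb z)) _⟩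

/-- The function `z ↦ |z + β|^(-2s)`. -/
noncomputable def kernel (hγ : 1 ≤ γ) (H : MoebiusDomain γ) (s : ℝ) (β : ℂ) (hβ : γ ≤ β.re) :
    C(H.closed, ℝ) :=
  ⟨fun z => ‖(z : ℂ) + β‖ ^ (-(2 * s)), Continuous.rpow_const (by fun_prop) fun z =>
    Or.inl (H.norm_add_pos hγ hβ z).ne'⟩

theorem kernel_apply (hγ : 1 ≤ γ) (H : MoebiusDomain γ) (s : ℝ) (β : ℂ) (hβ : γ ≤ β.re)
    (z : H.closed) : H.kernel hγ s β hβ z = ‖(z : ℂ) + β‖ ^ (-(2 * s)) := rfl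

theorem kernel_pos (hγ : 1 ≤ γ) (H : MoebiusDomain γ) (s : ℝ) (β : ℂ) (hβ : γ ≤ β.re)
    (z : H.closed) : 0 < H.kernel hγ s β hβ z :=
  Real.rpow_pos_of_pos (H.norm_add_pos hγ hβ z) _

/-- Inversion preserves the right half-plane, so the shifted parameter is again admissible. -/
theorem re_add_one_div {b β : ℂ} (hγ : 1 ≤ γ) (hb : γ ≤ b.re) (hβ : γ ≤ β.re) :
    γ ≤ (b + 1 / β).re := by
  rw [Complex.add_re, one_div, Complex.inv_re]
  have : 0 ≤ β.re / Complex.normSq β := div_nonneg (by linarith) (Complex.normSq_nonneg _)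
  linarith

/-- The family of kernels is invariant under the branches of the transfer operator. -/
theorem weightedComp_kernel (hγ : 1 ≤ γ) (H : MoebiusDomain γ) (s : ℝ) {b β : ℂ}
    (hb : γ ≤ b.re) (hβ : γ ≤ β.re) :
    weightedComp ℝ (H.thetaMap hγ b hb) (H.kernel hγ s b hb) (H.kernel hγ s β hβ) =
      ‖β‖ ^ (-(2 * s)) • H.kernel hγ s (b + 1 / β) (re_add_one_div hγ hb hβ) := by
  ext z
  have hzb := norm_pos_iff.mp (H.norm_add_pos hγ hb z)
  have hβ0 : β ≠ 0 := norm_pos_iff.mp (norm_pos_of_re_pos (by linarith))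
  simp only [weightedComp_apply, kernel_apply, ContinuousMap.smul_apply, smul_eq_mul,
    RCLike.ofReal_real_eq_id, id]
  rw [← Real.mul_rpow (norm_nonneg _) (norm_nonneg _),
    ← Real.mul_rpow (norm_nonneg _) (norm_nonneg _), ← norm_mul, ← norm_mul]
  congr 2
  -- The identity behind the whole proof: this product equals `β(z + b + 1/β)`.
  change ((z : ℂ) + b) * (1 / ((z : ℂ) + b) + β) = _
  field_simp
  ring

theorem summable_norm_kernel (hγ : 1 ≤ γ) (H : MoebiusDomain γ) {s : ℝ} (hs : 0 < s) {B : Set ℂ}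
    (hB : ∀ b ∈ B, γ ≤ b.re) (hsum : Summable (fun b : B => 1 / ‖(b : ℂ)‖ ^ (2 * s))) :
    Summable fun b : B => ‖H.kernel hγ s b (hB b b.2)‖ := by
  obtain ⟨R, hR0, hR⟩ := H.exists_norm_le
  refine Summable.of_nonneg_of_le (fun _ => norm_nonneg _) (fun b => ?_)
    (hsum.mul_left ((1 + R) ^ (2 * s)))
  rw [ContinuousMap.norm_le _ (by positivity)]
  intro z
  have hb := hB b b.2
  have hb0 : 0 < ‖(b : ℂ)‖ := norm_pos_of_re_pos (by linarith)
  have hzb := H.norm_add_pos hγ hb z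
  rw [Real.norm_of_nonneg (H.kernel_pos hγ s b hb z).le, kernel_apply, Real.rpow_neg hzb.le,
    mul_one_div, le_div_iff₀ (by positivity), inv_mul_le_iff₀ (by positivity), mul_comm (_ ^ (2 * s)),
    ← Real.mul_rpow (by positivity) hzb.le]
  exact Real.rpow_le_rpow hb0.le (norm_le_one_add_mul_norm_add hγ (H.re_nonneg z.2) hb (hR z))
    (by positivity)

/-- The closed convex cone generated by the kernels `|z + β|^(-2s)` with `Re β ≥ γ`. -/
noncomputable def kernelCone (hγ : 1 ≤ γ) (H : MoebiusDomain γ) (s : ℝ) :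
    Submodule NNReal C(H.closed, ℝ) :=
  (Submodule.span NNReal (range fun β : {β : ℂ // γ ≤ β.re} =>
    H.kernel hγ s β β.2)).topologicalClosure

theorem kernel_mem_kernelCone (hγ : 1 ≤ γ) (H : MoebiusDomain γ) (s : ℝ) (β : ℂ)
    (hβ : γ ≤ β.re) : H.kernel hγ s β hβ ∈ H.kernelCone hγ s :=
  Submodule.le_topologicalClosure _ (Submodule.subset_span ⟨⟨β, hβ⟩, rfl⟩)

theorem isClosed_kernelCone (hγ : 1 ≤ γ) (H : MoebiusDomain γ) (s : ℝ) :
    IsClosed (H.kernelCone hγ s : Set C(H.closed, ℝ)) :=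
  Submodule.isClosed_topologicalClosure _

/-- Induction principle for the cone generated by the kernels. -/
theorem kernelCone_induction {hγ : 1 ≤ γ} {H : MoebiusDomain γ} {s : ℝ}
    {p : C(H.closed, ℝ) → Prop} (hcl : IsClosed {f | p f})
    (hker : ∀ (β : ℂ) (hβ : γ ≤ β.re), p (H.kernel hγ s β hβ)) (h0 : p 0)
    (hadd : ∀ f g, p f → p g → p (f + g))
    (hsmul : ∀ (c : NNReal) f, p f → p (c • f)) {f : C(H.closed, ℝ)}
    (hf : f ∈ H.kernelCone hγ s) : p f := by
  have h : (Submodule.span NNReal (range fun β : {β : ℂ // γ ≤ β.re} =>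
      H.kernel hγ s β β.2) : Set C(H.closed, ℝ)) ⊆ {f | p f} := by
    intro g hg
    refine Submodule.span_induction ?_ h0 (fun f g _ _ => hadd f g) (fun c f _ => hsmul c f) hg
    rintro _ ⟨β, rfl⟩
    exact hker β β.2
  exact closure_minimal h hcl hf

/-- The inequality is preserved by sums, nonnegative multiples and limits, so it need only be
checked on kernels. All three estimates for `v` are obtained this way. -/
theorem kernelCone_le_mul {hγ : 1 ≤ γ} {H : MoebiusDomain γ} {s : ℝ} {x y : H.closed} {E : ℝ}
    (h : ∀ (β : ℂ) (hβ : γ ≤ β.re), H.kernel hγ s β hβ x ≤ H.kernel hγ s β hβ y * E)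
    {f : C(H.closed, ℝ)} (hf : f ∈ H.kernelCone hγ s) : f x ≤ f y * E := by
  refine kernelCone_induction (p := fun f => f x ≤ f y * E) ?_ h (by simp) ?_ ?_ hf
  · exact isClosed_le (ContinuousMap.evalCLM ℝ x).continuous
      ((ContinuousMap.evalCLM ℝ y).continuous.mul_const E)
  · intro f g hf hg
    simp only [ContinuousMap.add_apply]
    linarith
  · intro c f hf
    have := mul_le_mul_of_nonneg_left hf c.2
    change (c : ℝ) * f x ≤ (c : ℝ) * f y * E
    rw [mul_assoc]
    exact this

theorem kernelCone_nonneg {hγ : 1 ≤ γ} {H : MoebiusDomain γ} {s : ℝ}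
    {f : C(H.closed, ℝ)} (hf : f ∈ H.kernelCone hγ s) (x : H.closed) : 0 ≤ f x := by
  refine kernelCone_induction (p := fun f => 0 ≤ f x) ?_ (fun β hβ => (H.kernel_pos hγ s β hβ x).le)
    (by simp) (fun f g hf hg => add_nonneg hf hg) (fun c f hf => mul_nonneg c.2 hf) hf
  exact isClosed_le continuous_const (ContinuousMap.evalCLM ℝ x).continuous

theorem kernelCone_le_mul_exp {hγ : 1 ≤ γ} {H : MoebiusDomain γ} {s : ℝ} (hs : 0 < s)
    {f : C(H.closed, ℝ)} (hf : f ∈ H.kernelCone hγ s) (x y : H.closed) :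
    f x ≤ f y * Real.exp (2 * s / γ * ‖(y : ℂ) - x‖) := by
  refine kernelCone_le_mul (fun β hβ => ?_) hf
  rw [show 2 * s / γ * ‖(y : ℂ) - x‖ = 2 * s * (‖(y : ℂ) - x‖ / γ) by ring]
  exact rpow_neg_le_mul_exp (H.norm_add_pos hγ hβ x) (H.norm_add_pos hγ hβ y) (by positivity)
    (norm_add_le_mul_exp (by linarith) (H.re_nonneg x.2) hβ)

theorem kernelCone_antitone_re {hγ : 1 ≤ γ} {H : MoebiusDomain γ} {s : ℝ} (hs : 0 < s)
    {f : C(H.closed, ℝ)} (hf : f ∈ H.kernelCone hγ s) {x y : H.closed}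
    (him : (x : ℂ).im = (y : ℂ).im) (hre : (x : ℂ).re ≤ (y : ℂ).re) : f y ≤ f x := by
  have := kernelCone_le_mul (x := y) (y := x) (E := 1) (fun β hβ => ?_) hf
  · simpa using this
  rw [mul_one, kernel_apply, kernel_apply]
  refine Real.rpow_le_rpow_of_nonpos (H.norm_add_pos hγ hβ x) ?_ (by linarith)
  apply le_of_sq_le_sq _ (norm_nonneg _)
  rw [← Complex.normSq_eq_norm_sq, ← Complex.normSq_eq_norm_sq, Complex.normSq_apply,
    Complex.normSq_apply]
  simp only [Complex.add_re, Complex.add_im, him]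
  have := H.re_nonneg x.2
  nlinarith

theorem kernelCone_le_mul_exp_im {hγ : 1 ≤ γ} {H : MoebiusDomain γ} {s : ℝ} (hs : 0 < s)
    {f : C(H.closed, ℝ)} (hf : f ∈ H.kernelCone hγ s) {x y : H.closed}
    (hre : (x : ℂ).re = (y : ℂ).re) :
    f x ≤ f y * Real.exp (s / γ * |(x : ℂ).im - (y : ℂ).im|) := by
  refine kernelCone_le_mul (fun β hβ => ?_) hf
  rw [show s / γ * |(x : ℂ).im - (y : ℂ).im| =
    2 * s * (|(y : ℂ).im - (x : ℂ).im| / (2 * γ)) by rw [abs_sub_comm]; field_simp]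
  exact rpow_neg_le_mul_exp (H.norm_add_pos hγ hβ x) (H.norm_add_pos hγ hβ y) (by positivity)
    (norm_add_le_mul_exp_of_re_eq (by linarith) (H.re_nonneg x.2) hre hβ)

/-- `L_s` on the real or complex continuous functions. -/
noncomputable def moebiusOp (𝕜 : Type*) [RCLike 𝕜] (hγ : 1 ≤ γ) (H : MoebiusDomain γ) {B : Set ℂ}
    (hB : ∀ b ∈ B, γ ≤ b.re) (s : ℝ) : C(H.closed, 𝕜) →L[𝕜] C(H.closed, 𝕜) :=
  transferOp 𝕜 (fun b : B => H.thetaMap hγ b (hB b b.2)) (fun b : B => H.kernel hγ s b (hB b b.2))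

theorem isTransferOperator_moebiusOp (hγ : 1 ≤ γ) (H : MoebiusDomain γ) {B : Set ℂ}
    (hB : ∀ b ∈ B, γ ≤ b.re) {s : ℝ} (hs : 0 < s)
    (hsum : Summable (fun b : B => 1 / ‖(b : ℂ)‖ ^ (2 * s))) :
    H.IsTransferOperator hγ B hB s (H.moebiusOp ℂ hγ hB s) := by
  intro f z
  have h := hasSum_transferOp_apply ℂ (fun b : B => H.thetaMap hγ b (hB b b.2))
    (H.summable_norm_kernel hγ hs hB hsum) f z
  refine h.congr_fun fun b => ?_
  rw [kernel_apply, Real.rpow_neg (norm_nonneg _), div_eq_inv_mul]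
  push_cast
  rfl

/-- On a kernel the partial sums of the series are nonnegative combinations of kernels, and the
series converges in norm; continuity and linearity do the rest. -/
theorem moebiusOp_mem_kernelCone (hγ : 1 ≤ γ) (H : MoebiusDomain γ) {B : Set ℂ}
    (hB : ∀ b ∈ B, γ ≤ b.re) {s : ℝ} (hs : 0 < s)
    (hsum : Summable (fun b : B => 1 / ‖(b : ℂ)‖ ^ (2 * s))) {f : C(H.closed, ℝ)}
    (hf : f ∈ H.kernelCone hγ s) : H.moebiusOp ℝ hγ hB s f ∈ H.kernelCone hγ s := by
  refine kernelCone_induction (p := fun f => H.moebiusOp ℝ hγ hB s f ∈ H.kernelCone hγ s)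
    ?_ ?_ (by simp) ?_ ?_ hf
  · exact (H.isClosed_kernelCone hγ s).preimage (H.moebiusOp ℝ hγ hB s).continuous
  · intro β hβ
    have h := hasSum_transferOp ℝ (fun b : B => H.thetaMap hγ b (hB b b.2))
      (H.summable_norm_kernel hγ hs hB hsum) (H.kernel hγ s β hβ)
    refine (H.isClosed_kernelCone hγ s).mem_of_tendsto h (Eventually.of_forall fun t => ?_)
    refine Submodule.sum_mem _ fun b _ => ?_
    rw [weightedComp_kernel]
    exact Submodule.smul_mem _ (⟨‖β‖ ^ (-(2 * s)), by positivity⟩ : NNReal)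
      (H.kernel_mem_kernelCone hγ s _ _)
  · intro f g hf hg
    rw [map_add]
    exact Submodule.add_mem _ hf hg
  · intro c f hf
    have : H.moebiusOp ℝ hγ hB s (c • f) = c • H.moebiusOp ℝ hγ hB s f :=
      map_smul (H.moebiusOp ℝ hγ hB s) (c : ℝ) f
    rw [this]
    exact Submodule.smul_mem _ c hf

/-- Two steps are needed: for `b = 1` the derivative of `θ_b` has modulus `1` at `0`. The factor
`1/4` comes from two denominators of modulus at least `2`. -/
theorem theta_theta_dist_le (hγ : 1 ≤ γ) (H : MoebiusDomain γ) {b : ℂ} (hb : γ ≤ b.re)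
    (x y : H.closed) : dist (H.theta hγ b hb (H.theta hγ b hb x))
      (H.theta hγ b hb (H.theta hγ b hb y)) ≤ 1 / 4 * dist x y := by
  have hre : ∀ z : H.closed, 1 ≤ ((z : ℂ) + b).re := fun z => by
    have := H.re_nonneg z.2
    simp only [Complex.add_re]; linarith
  have hform : ∀ z : H.closed, ((H.theta hγ b hb (H.theta hγ b hb z) : H.closed) : ℂ) =
      (z + b) / (1 + b * (z + b)) := fun z => by
    have h0 := norm_pos_iff.mp (H.norm_add_pos hγ hb z)
    have h1 : 1 + b * ((z : ℂ) + b) ≠ 0 := norm_pos_iff.mp (lt_of_lt_of_le two_pos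
      (two_le_norm_one_add_mul (hγ.trans hb) (hre z)))
    change 1 / (1 / ((z : ℂ) + b) + b) = _
    have h2 : 1 / ((z : ℂ) + b) + b ≠ 0 := by
      have : 1 / ((z : ℂ) + b) + b = (1 + b * ((z : ℂ) + b)) / ((z : ℂ) + b) := by
        field_simp
      rw [this]
      exact div_ne_zero h1 h0
    field_simp
  have hx := two_le_norm_one_add_mul (hγ.trans hb) (hre x)
  have hy := two_le_norm_one_add_mul (hγ.trans hb) (hre y)
  have hx0 : 1 + b * ((x : ℂ) + b) ≠ 0 := norm_pos_iff.mp (lt_of_lt_of_le two_pos hx)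
  have hy0 : 1 + b * ((y : ℂ) + b) ≠ 0 := norm_pos_iff.mp (lt_of_lt_of_le two_pos hy)
  rw [Subtype.dist_eq, Subtype.dist_eq, dist_eq_norm, dist_eq_norm, hform, hform,
    show ((x : ℂ) + b) / (1 + b * (x + b)) - (y + b) / (1 + b * (y + b)) =
      (x - y) / ((1 + b * (x + b)) * (1 + b * (y + b))) by
        rw [div_sub_div _ _ hx0 hy0]; congr 1; ring, norm_div, norm_mul,
    div_le_iff₀ (by positivity)]
  have h4 : 4 ≤ ‖1 + b * ((x : ℂ) + b)‖ * ‖1 + b * ((y : ℂ) + b)‖ := by nlinarith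
  nlinarith [norm_nonneg ((x : ℂ) - y)]

theorem tendsto_sub_iterate_theta (hγ : 1 ≤ γ) (H : MoebiusDomain γ) {b : ℂ} (hb : γ ≤ b.re)
    (g : C(H.closed, ℝ)) (x y : H.closed) :
    Tendsto (fun n => g ((H.thetaMap hγ b hb)^[n] x) - g ((H.thetaMap hγ b hb)^[n] y))
      atTop (𝓝 0) := by
  set T := H.thetaMap hγ b hb
  have hd2 : ∀ n, ∀ x y : H.closed, dist (T^[2 * n] x) (T^[2 * n] y) ≤ (1 / 4) ^ n * dist x y := by
    intro n
    induction n with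
    | zero => simp
    | succ n ih =>
      intro x y
      rw [Nat.mul_succ, Function.iterate_add_apply, Function.iterate_add_apply]
      refine (ih _ _).trans ?_
      rw [pow_succ, mul_assoc]
      gcongr
      exact H.theta_theta_dist_le hγ hb x y
  have hpow : ∀ D : ℝ, Tendsto (fun n : ℕ => (1 / 4 : ℝ) ^ (n / 2) * D) atTop (𝓝 0) := fun D => by
    have h1 : Tendsto (fun n : ℕ => n / 2) atTop atTop := Nat.tendsto_div_const_atTop two_ne_zero
    have := ((tendsto_pow_atTop_nhds_zero_of_lt_one (r := (1 / 4 : ℝ)) (by norm_num)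
      (by norm_num)).comp h1).mul_const D
    simpa [Function.comp_def] using this
  have hd : Tendsto (fun n => dist (T^[n] x) (T^[n] y)) atTop (𝓝 0) := by
    refine squeeze_zero (fun _ => dist_nonneg) (fun n => ?_)
      (hpow (max (dist x y) (dist (T x) (T y))))
    rcases Nat.even_or_odd' n with ⟨k, rfl | rfl⟩
    · rw [Nat.mul_div_cancel_left _ two_pos]
      exact (hd2 k x y).trans (mul_le_mul_of_nonneg_left (le_max_left _ _) (by positivity))
    · rw [show (2 * k + 1) / 2 = k by omega, Function.iterate_succ_apply,
        Function.iterate_succ_apply]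
      exact (hd2 k _ _).trans (mul_le_mul_of_nonneg_left (le_max_right _ _) (by positivity))
  have huc := CompactSpace.uniformContinuous_of_continuous g.continuous
  rw [Metric.uniformContinuous_iff] at huc
  rw [Metric.tendsto_atTop]
  intro ε hε
  obtain ⟨δ, hδ, h⟩ := huc ε hε
  obtain ⟨N, hN⟩ := (Metric.tendsto_atTop.mp hd) δ hδ
  refine ⟨N, fun n hn => ?_⟩
  have h1 := hN n hn
  rw [Real.dist_eq, sub_zero, abs_of_nonneg dist_nonneg] at h1
  have := h h1
  rwa [Real.dist_eq, sub_zero, ← Real.dist_eq]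

end MoebiusDomain

/-! ### Conjugation, and the general results applied to `L_s` -/

namespace MoebiusDomain

variable {γ : ℝ}

theorem conj_mem_closed (H : MoebiusDomain γ) (hH : ConjSymmetric H.carrier) {z : ℂ}
    (hz : z ∈ H.closed) : (starRingEnd ℂ) z ∈ H.closed :=
  map_mem_closure Complex.continuous_conj hz fun w hw => by
    rw [hH]; exact ⟨w, hw, rfl⟩

/-- Complex conjugation as a map of a conjugation symmetric domain. -/
noncomputable def conjMap (H : MoebiusDomain γ) (hH : ConjSymmetric H.carrier) :
    C(H.closed, H.closed) :=
  ⟨fun z => ⟨(starRingEnd ℂ) z, H.conj_mem_closed hH z.2⟩,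
    Continuous.subtype_mk (Complex.continuous_conj.comp continuous_subtype_val) _⟩

theorem coe_conjMap (H : MoebiusDomain γ) (hH : ConjSymmetric H.carrier) (z : H.closed) :
    (H.conjMap hH z : ℂ) = (starRingEnd ℂ) z := rfl

theorem conjMap_conjMap (H : MoebiusDomain γ) (hH : ConjSymmetric H.carrier) (z : H.closed) :
    H.conjMap hH (H.conjMap hH z) = z := by
  apply Subtype.ext
  rw [coe_conjMap, coe_conjMap, Complex.conj_conj]

/-- The transfer operator commutes with complex conjugation in the symmetric case. -/
theorem moebiusOp_comp_conjMap (hγ : 1 ≤ γ) (H : MoebiusDomain γ) {B : Set ℂ}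
    (hB : ∀ b ∈ B, γ ≤ b.re) {s : ℝ} (hs : 0 < s)
    (hsum : Summable (fun b : B => 1 / ‖(b : ℂ)‖ ^ (2 * s)))
    (hBc : ConjSymmetric B) (hH : ConjSymmetric H.carrier) (f : C(H.closed, ℝ)) :
    H.moebiusOp ℝ hγ hB s (f.comp (H.conjMap hH)) =
      (H.moebiusOp ℝ hγ hB s f).comp (H.conjMap hH) := by
  have hmem : ∀ b ∈ B, (starRingEnd ℂ) b ∈ B := fun b hb => by
    rw [hBc]; exact ⟨b, hb, rfl⟩
  let e : B ≃ B :=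
    { toFun := fun b => ⟨(starRingEnd ℂ) b, hmem b b.2⟩
      invFun := fun b => ⟨(starRingEnd ℂ) b, hmem b b.2⟩
      left_inv := fun b => Subtype.ext (Complex.conj_conj _)
      right_inv := fun b => Subtype.ext (Complex.conj_conj _) }
  have hw := H.summable_norm_kernel hγ hs hB hsum
  ext z
  refine (hasSum_transferOp_apply ℝ (fun b : B => H.thetaMap hγ b (hB b b.2)) hw _ z).unique ?_
  have h := hasSum_transferOp_apply ℝ (fun b : B => H.thetaMap hγ b (hB b b.2)) hw f
    (H.conjMap hH z)
  -- Conjugation permutes `B`, so the sum at `z̄` may be reindexed by `b ↦ b̄` and compared term by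
  -- term.
  rw [← e.hasSum_iff] at h
  refine h.congr_fun fun b => ?_
  have h1 : H.kernel hγ s (e b) (hB _ (e b).2) (H.conjMap hH z) =
      H.kernel hγ s b (hB b b.2) z := by
    rw [kernel_apply, kernel_apply, coe_conjMap]
    change ‖(starRingEnd ℂ) (z : ℂ) + (starRingEnd ℂ) (b : ℂ)‖ ^ _ = _
    rw [← map_add, RCLike.norm_conj]
  have h2 : H.conjMap hH (H.thetaMap hγ b (hB b b.2) z) =
      H.thetaMap hγ (e b) (hB _ (e b).2) (H.conjMap hH z) := by
    apply Subtype.ext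
    change (starRingEnd ℂ) (1 / ((z : ℂ) + b)) =
      1 / ((starRingEnd ℂ) (z : ℂ) + (starRingEnd ℂ) (b : ℂ))
    rw [map_div₀, map_one, map_add]
  simp only [Function.comp_apply, ContinuousMap.comp_apply, h1, h2]

theorem toComplex_apply (H : MoebiusDomain γ) (u : C(H.closed, ℝ)) (z : H.closed) :
    H.toComplex u z = (u z : ℂ) := rfl

theorem moebiusOp_toComplex (hγ : 1 ≤ γ) (H : MoebiusDomain γ) {B : Set ℂ}
    (hB : ∀ b ∈ B, γ ≤ b.re) {s : ℝ} (hs : 0 < s)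
    (hsum : Summable (fun b : B => 1 / ‖(b : ℂ)‖ ^ (2 * s))) (u : C(H.closed, ℝ))
    (z : H.closed) :
    H.moebiusOp ℂ hγ hB s (H.toComplex u) z = (H.moebiusOp ℝ hγ hB s u z : ℂ) :=
  transferOp_ofReal (H.summable_norm_kernel hγ hs hB hsum) (fun _ => rfl) z

theorem moebiusOp_nonneg (hγ : 1 ≤ γ) (H : MoebiusDomain γ) {B : Set ℂ}
    (hB : ∀ b ∈ B, γ ≤ b.re) {s : ℝ} (hs : 0 < s)
    (hsum : Summable (fun b : B => 1 / ‖(b : ℂ)‖ ^ (2 * s))) (f : C(H.closed, ℝ))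
    (hf : 0 ≤ f) : 0 ≤ H.moebiusOp ℝ hγ hB s f :=
  transferOp_nonneg (H.summable_norm_kernel hγ hs hB hsum) (fun _ _ => (H.kernel_pos ..).le) f hf

theorem moebiusOp_pos (hγ : 1 ≤ γ) (H : MoebiusDomain γ) {B : Set ℂ}
    (hB : ∀ b ∈ B, γ ≤ b.re) {s : ℝ} (hs : 0 < s)
    (hsum : Summable (fun b : B => 1 / ‖(b : ℂ)‖ ^ (2 * s))) (hne : B.Nonempty)
    {u : C(H.closed, ℝ)} (hu : ∀ z, 0 < u z) (z : H.closed) : 0 < H.moebiusOp ℝ hγ hB s u z := by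
  obtain ⟨b₀, hb₀⟩ := hne
  have h := hasSum_transferOp_apply ℝ (fun b : B => H.thetaMap hγ b (hB b b.2))
    (H.summable_norm_kernel hγ hs hB hsum) u z
  have hpos : ∀ b : B, 0 < H.kernel hγ s b (hB b b.2) z *
      u (H.thetaMap hγ b (hB b b.2) z) := fun b => mul_pos (H.kernel_pos ..) (hu _)
  exact (hpos ⟨b₀, hb₀⟩).trans_le (le_hasSum h ⟨b₀, hb₀⟩ fun b _ => (hpos b).le)

theorem norm_moebiusOp_pow (hγ : 1 ≤ γ) (H : MoebiusDomain γ) {B : Set ℂ}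
    (hB : ∀ b ∈ B, γ ≤ b.re) {s : ℝ} (hs : 0 < s)
    (hsum : Summable (fun b : B => 1 / ‖(b : ℂ)‖ ^ (2 * s))) (n : ℕ) :
    ‖H.moebiusOp ℂ hγ hB s ^ n‖ = ‖H.moebiusOp ℝ hγ hB s ^ n‖ :=
  norm_transferOp_pow (H.summable_norm_kernel hγ hs hB hsum) (fun _ _ => (H.kernel_pos ..).le) n

theorem exists_smul_eq_of_moebiusOp_eq (hγ : 1 ≤ γ) (H : MoebiusDomain γ) {B : Set ℂ}
    (hB : ∀ b ∈ B, γ ≤ b.re) {s : ℝ} (hs : 0 < s)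
    (hsum : Summable (fun b : B => 1 / ‖(b : ℂ)‖ ^ (2 * s))) (hne : B.Nonempty)
    {u v : C(H.closed, ℝ)} (hu : ∀ z, 0 < u z) (hv : ∀ z, 0 < v z) {r : ℝ}
    (hru : H.moebiusOp ℝ hγ hB s u = r • u) (hrv : H.moebiusOp ℝ hγ hB s v = r • v) :
    ∃ c : ℝ, 0 < c ∧ u = c • v := by
  have := H.nonempty_closed hγ
  obtain ⟨b₀, hb₀⟩ := hne
  have hw := H.summable_norm_kernel hγ hs hB hsum
  have hT := H.tendsto_sub_iterate_theta hγ (hB b₀ hb₀)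
  exact exists_smul_eq_of_transferOp_eq (θ := fun b : B => H.thetaMap hγ b (hB b b.2))
    (w := fun b : B => H.kernel hγ s b (hB b b.2)) hw (fun _ _ => H.kernel_pos ..)
    ⟨b₀, hb₀⟩ hT hu hv hru hrv

/-- The powers of `L_s` are comparable with those of its spectral radius, and the cone generated
by the kernels contains a positive eigenfunction. -/
theorem exists_eigenfunction_moebiusOp (hγ : 1 ≤ γ) (H : MoebiusDomain γ) {B : Set ℂ}
    (hB : ∀ b ∈ B, γ ≤ b.re) {s : ℝ} (hs : 0 < s)
    (hsum : Summable (fun b : B => 1 / ‖(b : ℂ)‖ ^ (2 * s))) (hne : B.Nonempty)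
    {r : ℝ} (hlim : Tendsto (fun k : ℕ => ‖H.moebiusOp ℝ hγ hB s ^ k‖ ^ (1 / (k : ℝ))) atTop (𝓝 r)) :
    0 < r ∧ (∃ c C : ℝ, 0 < c ∧ ∀ n z, c * r ^ n ≤ (H.moebiusOp ℝ hγ hB s ^ n) 1 z ∧
      (H.moebiusOp ℝ hγ hB s ^ n) 1 z ≤ C * r ^ n) ∧
    ∃ v ∈ H.kernelCone hγ s, (∀ z, 0 < v z) ∧ H.moebiusOp ℝ hγ hB s v = r • v ∧
      ∃ K : NNReal, LipschitzWith K v := by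
  have := H.nonempty_closed hγ
  have hP := H.moebiusOp_nonneg hγ hB hs hsum
  have hPK : ∀ f ∈ H.kernelCone hγ s, H.moebiusOp ℝ hγ hB s f ∈ H.kernelCone hγ s := fun f hf =>
    H.moebiusOp_mem_kernelCone hγ hB hs hsum hf
  have hPpos := H.moebiusOp_pos hγ hB hs hsum hne (u := 1) fun _ => one_pos
  generalize H.moebiusOp ℝ hγ hB s = P at *
  -- The iteration is seeded with the kernel `β = γ`; any admissible `β` would serve.
  have hf₀K := H.kernel_mem_kernelCone hγ s γ (by simp)
  have hf₀ := H.kernel_pos hγ s γ (by simp)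
  generalize H.kernel hγ s γ (by simp) = f₀ at *
  have hPn : ∀ n, (P ^ n) f₀ ∈ H.kernelCone hγ s := by
    intro n
    induction n with
    | zero => simpa using hf₀K
    | succ n ih => rw [pow_succ', mul_apply_eq_comp]; exact hPK _ ih
  have hγ0 : 0 < γ := by linarith
  have hA : 0 ≤ 2 * s / γ := by positivity
  have hKA : ∀ f ∈ H.kernelCone hγ s, ∀ x y, f x ≤ f y * Real.exp (2 * s / γ * dist x y) :=
    fun f hf x y => by
      have := kernelCone_le_mul_exp hs hf x y
      rwa [dist_comm, Subtype.dist_eq, dist_eq_norm]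
  obtain ⟨hr, c, C, hc, -, hcC⟩ := exists_norm_pow_comparable hP hPpos hf₀
    (Real.exp_pos (2 * s / γ * Metric.diam (univ : Set H.closed))) (fun n x y => by
      rw [mul_comm]
      refine (hKA _ (hPn n) x y).trans ?_
      refine mul_le_mul_of_nonneg_left (Real.exp_le_exp.mpr ?_)
        (kernelCone_nonneg (hPn n) y)
      exact mul_le_mul_of_nonneg_left (Metric.dist_le_diam_of_mem isCompact_univ.isBounded
        (mem_univ x) (mem_univ y)) hA) hlim
  exact ⟨hr, ⟨c, C, hc, hcC⟩, exists_pos_eigenfunction hP hr hc hcC (H.kernelCone hγ s)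
    (H.isClosed_kernelCone hγ s) hPK (fun f hf => kernelCone_nonneg hf) hA hKA
    hf₀K hf₀⟩

end MoebiusDomain

/-! ### The spectral radius and the main theorem -/

/-- Gelfand's formula with a real-valued spectral radius. -/
theorem exists_spectralRadius_eq_ofReal {A : Type*} [NormedRing A] [NormedAlgebra ℂ A]
    [CompleteSpace A] (a : A) : ∃ r : ℝ, spectralRadius ℂ a = ENNReal.ofReal r ∧
      Tendsto (fun k : ℕ => ‖a ^ k‖ ^ (1 / (k : ℝ))) atTop (𝓝 r) := by
  have h := spectrum.pow_norm_pow_one_div_tendsto_nhds_spectralRadius a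
  have hne : spectralRadius ℂ a ≠ ⊤ := by
    refine ne_top_of_le_ne_top ?_ (spectrum.spectralRadius_le_pow_nnnorm_pow_one_div ℂ a 0)
    exact ENNReal.mul_ne_top (ENNReal.rpow_ne_top_of_nonneg (by simp) ENNReal.coe_ne_top)
      (ENNReal.rpow_ne_top_of_nonneg (by simp) ENNReal.coe_ne_top)
  refine ⟨(spectralRadius ℂ a).toReal, (ENNReal.ofReal_toReal hne).symm, ?_⟩
  refine ((ENNReal.tendsto_toReal hne).comp h).congr fun k => ?_
  exact ENNReal.toReal_ofReal (Real.rpow_nonneg (norm_nonneg _) _)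

theorem theorem5p10 (γ : ℝ) (hγ : 1 ≤ γ) (s : ℝ) (hs : 0 < s)
    (B : Set ℂ) (hBc : B.Countable) (hBi : B.Infinite) (hB : ∀ b ∈ B, γ ≤ b.re)
    (hsum : Summable (fun b : B => 1 / ‖(b : ℂ)‖ ^ (2 * s)))
    (H : MoebiusDomain γ) :
    -- `L_s` is a bounded linear map of `C(H̄, ℂ)`, and `r` is its spectral radius
    ∃ L : C(H.closed, ℂ) →L[ℂ] C(H.closed, ℂ), H.IsTransferOperator hγ B hB s L ∧
    ∃ r : ℝ, 0 < r ∧ spectralRadius ℂ L = ENNReal.ofReal r ∧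
      Tendsto (fun k : ℕ => ‖L ^ k‖ ^ (1 / (k : ℝ))) atTop (𝓝 r) ∧
    -- a strictly positive Lipschitz eigenfunction
    ∃ v : C(H.closed, ℝ), (∀ z, 0 < v z) ∧ (∃ K : NNReal, LipschitzWith K v) ∧
      L (H.toComplex v) = (r : ℂ) • H.toComplex v ∧
      -- uniqueness among all strictly positive continuous eigenfunctions
      (∀ (u : C(H.closed, ℝ)) (μ : ℂ), (∀ z, 0 < u z) →
        L (H.toComplex u) = μ • H.toComplex u → μ = (r : ℂ) ∧ ∃ c : ℝ, 0 < c ∧ u = c • v) ∧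
      -- the three Harnack-type estimates
      (∀ z₀ z₁ : H.closed,
        v z₀ ≤ v z₁ * Real.exp (√5 * s / γ * ‖(z₁ : ℂ) - z₀‖)) ∧
      (∀ z₁ z₂ : H.closed, (z₁ : ℂ).im = (z₂ : ℂ).im → (z₁ : ℂ).re ≤ (z₂ : ℂ).re →
        v z₂ ≤ v z₁ ∧
        v z₁ * Real.exp (-(2 * s / γ) * ((z₂ : ℂ).re - (z₁ : ℂ).re)) ≤ v z₂) ∧
      (∀ z₁ z₂ : H.closed, (z₁ : ℂ).re = (z₂ : ℂ).re →
        v z₁ ≤ v z₂ * Real.exp (s / γ * |(z₁ : ℂ).im - (z₂ : ℂ).im|)) ∧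
      -- invariance under conjugation
      (ConjSymmetric B → ConjSymmetric H.carrier →
        ∀ z : H.closed, ∃ hz : (starRingEnd ℂ) (z : ℂ) ∈ H.closed,
          v ⟨(starRingEnd ℂ) (z : ℂ), hz⟩ = v z) := by

  have hne : Nonempty H.closed := H.nonempty_closed hγ
  obtain ⟨r, hspec, hlim⟩ := exists_spectralRadius_eq_ofReal (H.moebiusOp ℂ hγ hB s)
  obtain ⟨hr, ⟨c, C, hc, hcC⟩, v, hvK, hv, hPv, hvL⟩ :=
    H.exists_eigenfunction_moebiusOp hγ hB hs hsum hBi.nonempty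
      (hlim.congr fun k => by rw [H.norm_moebiusOp_pow hγ hB hs hsum])
  have hP := H.moebiusOp_nonneg hγ hB hs hsum
  have hPpos := fun u => H.moebiusOp_pos hγ hB hs hsum hBi.nonempty (u := u)
  have hLP := H.moebiusOp_toComplex hγ hB hs hsum
  have hPconj := H.moebiusOp_comp_conjMap hγ hB hs hsum
  have huniq : ∀ u : C(H.closed, ℝ), (∀ z, 0 < u z) → H.moebiusOp ℝ hγ hB s u = r • u →
      ∃ c : ℝ, 0 < c ∧ u = c • v :=
    fun u hu hPu => H.exists_smul_eq_of_moebiusOp_eq hγ hB hs hsum hBi.nonempty hu hv hPu hPv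
  generalize H.moebiusOp ℝ hγ hB s = P at *
  refine ⟨H.moebiusOp ℂ hγ hB s, H.isTransferOperator_moebiusOp hγ hB hs hsum, r, hr, hspec, hlim,
    v, hv, hvL, ?_, ?_, ?_, ?_, ?_, ?_⟩
  · ext z
    rw [hLP, hPv]
    simp [MoebiusDomain.toComplex_apply]
  · intro u μ hu hLu
    have hz : ∀ z, (P u z : ℂ) = μ * (u z : ℂ) := fun z => by
      have := congrArg (fun f : C(H.closed, ℂ) => f z) hLu
      simp only [ContinuousMap.smul_apply, smul_eq_mul, MoebiusDomain.toComplex_apply] at this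
      rwa [hLP] at this
    obtain ⟨x⟩ := id hne
    -- Evaluation at one point shows that `μ` is real and positive.
    have hμ : μ = ((P u x / u x : ℝ) : ℂ) := by
      have : (u x : ℂ) ≠ 0 := by exact_mod_cast (hu x).ne'
      push_cast
      rw [eq_div_iff this, hz]
    set m := P u x / u x
    have hm : 0 < m := div_pos (hPpos u hu x) (hu x)
    have hPu : P u = m • u := by
      ext z
      have := hz z
      rw [hμ] at this
      rw [ContinuousMap.smul_apply, smul_eq_mul]
      exact_mod_cast this
    have hmr : m = r := eigenvalue_eq_of_comparable hP hr hc hcC hu hm hPu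
    exact ⟨by rw [hμ, hmr], huniq u hu (hmr ▸ hPu)⟩
  · intro z₀ z₁
    refine (MoebiusDomain.kernelCone_le_mul_exp hs hvK z₀ z₁).trans ?_
    refine mul_le_mul_of_nonneg_left (Real.exp_le_exp.mpr ?_) (hv z₁).le
    gcongr
    -- The cone satisfies the estimate with the smaller constant `2 ≤ √5`.
    exact Real.le_sqrt_of_sq_le (by norm_num)
  · intro z₁ z₂ him hre
    refine ⟨MoebiusDomain.kernelCone_antitone_re hs hvK him hre, ?_⟩
    have h := MoebiusDomain.kernelCone_le_mul_exp hs hvK z₁ z₂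
    have hn : ‖(z₂ : ℂ) - z₁‖ = (z₂ : ℂ).re - (z₁ : ℂ).re := by
      have : (z₂ : ℂ) - z₁ = (((z₂ : ℂ).re - (z₁ : ℂ).re : ℝ) : ℂ) := by
        apply Complex.ext <;> simp [him]
      rw [this, Complex.norm_real, Real.norm_of_nonneg (sub_nonneg.mpr hre)]
    rw [hn] at h
    rw [neg_mul, Real.exp_neg, ← div_eq_mul_inv, div_le_iff₀ (Real.exp_pos _)]
    exact h
  · intro z₁ z₂ hre
    exact MoebiusDomain.kernelCone_le_mul_exp_im hs hvK hre
  · intro hBs hHs z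
    refine ⟨(H.conjMap hHs z).2, ?_⟩
    -- The conjugate of `v` is a positive eigenfunction, hence `k • v`. Conjugating twice gives `k²
    -- = 1`, and `k > 0`.
    obtain ⟨k, hk, hvk⟩ := huniq (v.comp (H.conjMap hHs)) (fun z => hv _) (by
      rw [hPconj hBs hHs, hPv]
      rfl)
    have hkz : ∀ z, v (H.conjMap hHs z) = k * v z := fun z =>
      congrArg (fun f : C(H.closed, ℝ) => f z) hvk
    have h2 := hkz (H.conjMap hHs z)
    rw [H.conjMap_conjMap, hkz, ← mul_assoc] at h2
    have hk2 : k * k = 1 := by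
      have := hv z
      exact mul_right_cancel₀ this.ne' (by rw [one_mul]; exact h2.symm)
    have hk1 : k = 1 := by nlinarith
    have := hkz z
    rwa [hk1, one_mul] at this
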